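/- Let $(K_0,v)$ be a valued field. Suppose that for every coarsening $w$ of $v$ (including $v$ itself) we are given a maximal immediate extension $(N_w|K_0,w)$, i.e. an immediate extension such that $(N_w,w)$ has no proper immediate extension, in which $K_0$ is relatively separable-algebraically closed (every element of $N_w$ that is separable-algebraic over $K_0$ lies in $K_0$). Let $(K|K_0,v)$ be a finite extension of valued fields which is defectless, i.e. $[K:K_0]=\sum_i (v_iK:v_iK_0)\,[Kv_i:K_0v_i]$, where $v_i$ runs over all extensions of $v|_{K_0}$ to $K$. Then for every coarsening $w$ of $v$ on $K_0$ (including $v$ itself) the following holds. There is a unique coarsening of the valuation $v$ of $K$ that extends $w$; denote it by $w$ again. Let $M_w=N_w.K$ be a compositum of $N_w$ and $K$, that is, a field containing $N_w$ and $K$ with the same subfield $K_0$ and generated by them. Then the valuation $w$ of $N_w$ has a unique extension to $M_w$, again denoted by $w$; with it, $(M_w,w)$ is a maximal immediate extension of $(K,w)$, and $K$ is relatively separable-algebraically closed in $M_w$. -/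

import Mathlib

namespace ValuedFieldExt

universe u v

section

variable {K : Type u} {L : Type v} [Field K] [Field L] [Algebra K L]

/-- A valuation of a field is given, up to equivalence, by its valuation ring.
`Extends V V'` says that the valuation of `L` with ring `V'` restricts to the valuation of `K` with
ring `V`, that is, `(L|K, V')` is an extension of valued fields. -/
def Extends (V : ValuationSubring K) (V' : ValuationSubring L) : Prop :=
  V'.comap (algebraMap K L) = V

theorem Extends.mem_iff {V : ValuationSubring K} {V' : ValuationSubring L} (h : Extends V V')
    (x : K) : algebraMap K L x ∈ V' ↔ x ∈ V := by
  rw [← h, ValuationSubring.mem_comap]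

/-- The inclusion of valuation rings of an extension of valued fields. -/
def Extends.ringMap {V : ValuationSubring K} {V' : ValuationSubring L} (h : Extends V V') :
    V →+* V' :=
  ((algebraMap K L).comp V.subtype).codRestrict V' fun x => (h.mem_iff x.1).2 x.2

theorem Extends.isLocalHom_ringMap {V : ValuationSubring K} {V' : ValuationSubring L}
    (h : Extends V V') : IsLocalHom h.ringMap := by
  refine ⟨fun x hx => ?_⟩
  obtain ⟨y, hy⟩ := hx.exists_right_inv
  have hy' : algebraMap K L x.1 * y.1 = 1 := congrArg Subtype.val hy
  have hx0 : (x : K) ≠ 0 := by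
    rintro h0
    rw [h0] at hy'
    simp at hy'
  have hmem : (x : K)⁻¹ ∈ V := by
    rw [← h.mem_iff, map_inv₀, inv_eq_of_mul_eq_one_right hy']
    exact y.2
  exact IsUnit.of_mul_eq_one ⟨(x : K)⁻¹, hmem⟩ (Subtype.ext (mul_inv_cancel₀ hx0))

/-- The embedding of residue fields `Kv → Lv` of an extension of valued fields. -/
noncomputable def Extends.residueMap {V : ValuationSubring K} {V' : ValuationSubring L}
    (h : Extends V V') : IsLocalRing.ResidueField V →+* IsLocalRing.ResidueField V' :=
  haveI := h.isLocalHom_ringMap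
  IsLocalRing.ResidueField.map h.ringMap

/-- The inertia degree `[Lv : Kv]`. -/
noncomputable def Extends.inertiaDegree {V : ValuationSubring K} {V' : ValuationSubring L}
    (h : Extends V V') : ℕ :=
  letI := h.residueMap.toAlgebra
  Module.finrank (IsLocalRing.ResidueField V) (IsLocalRing.ResidueField V')

variable (K) in
/-- The value group of `K`, as a subgroup of the value group `vL` of the valuation with
ring `V'` on `L`. -/
noncomputable def valueSubgroup (V' : ValuationSubring L) : Subgroup V'.ValueGroupˣ :=
  (Units.map ((V'.valuation : L →* V'.ValueGroup).comp (algebraMap K L : K →* L))).range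

variable (K) in
/-- The ramification index `(vL : vK)`. -/
noncomputable def ramificationIndex (V' : ValuationSubring L) : ℕ :=
  (valueSubgroup K V').index

/-- A finite extension `L|K` is defectless with respect to the valuation of `K` with ring `V` if
the fundamental equality `[L : K] = ∑ eᵢ fᵢ` holds, where the sum is over all extensions of the
valuation from `K` to `L`. -/
def IsDefectless (L : Type v) [Field L] [Algebra K L] (V : ValuationSubring K) : Prop :=
  FiniteDimensional K L ∧
    Module.finrank K L =
      ∑ᶠ V' : {V' : ValuationSubring L // Extends V V'},
        ramificationIndex K V'.1 * V'.2.inertiaDegree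

/-- An extension of valued fields is immediate if the embeddings `vK → vL` and `Kv → Lv` are
onto. -/
def IsImmediate (V : ValuationSubring K) (V' : ValuationSubring L) : Prop :=
  ∃ h : Extends V V', valueSubgroup K V' = ⊤ ∧ Function.Surjective h.residueMap

end

/-- A valued field is maximal if it has no proper immediate extension. (Every proper immediate
extension contains one that is generated by a single element, so the restriction to one universe
is harmless.) -/
def IsMaximal {K : Type u} [Field K] (V : ValuationSubring K) : Prop :=
  ∀ (F : Type u) [Field F] [Algebra K F] (V' : ValuationSubring F),
    IsImmediate V V' → Function.Surjective (algebraMap K F)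

/-- `(L|K, V')` is a maximal immediate extension of `(K, V)`. -/
def IsMaximalImmediate {K : Type u} {L : Type v} [Field K] [Field L] [Algebra K L]
    (V : ValuationSubring K) (V' : ValuationSubring L) : Prop :=
  IsImmediate V V' ∧ IsMaximal V'

/-- `K` is relatively separable-algebraically closed in `F`: every element of `F` that is
separable-algebraic over `K` lies in `K`. -/
def IsRelSepClosed (K : Type u) (F : Type v) [Field K] [Field F] [Algebra K F] : Prop :=
  separableClosure K F = ⊥

end ValuedFieldExt

/-! The link between maximality and algebra is spherical completeness: chains of cosets of
submodules over the valuation ring have a common point. By Kaplansky's theorem a maximal field is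
spherically complete (`IsMaximal.isSphericallyComplete`), and the converse holds as well
(`IsSphericallyComplete.isMaximal`). The property passes to finite powers and to surjective images,
hence from `N_w` to the finite extension `M_w`, which is therefore maximal.

Spherical completeness also gives Hensel's factorization
(`exists_monic_dvd_of_isSphericallyComplete`). Monic factors over `N_w` of separable polynomials
over `K₀` have coefficients in `K₀`, so `K₀` inherits henselianity for every `w`
(`Extends.eq_of_extends`). Extensions to `K` are thus unique, and defectlessness reads `[K : K₀] = e
f` for the single extension `v`. Lifting a residue basis and representatives of the value cosets
then gives a valuation basis of `K|K₀` for `v` (`Extends.exists_isValuationBasis`), which remains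
one for every coarsening `w`.

That basis spans `M_w` over `N_w`. Approximating coefficients in `N_w` by elements of `K₀`
approximates each element of `M_w` by an element of `K` (`IsValuationBasis.valuation_sum_sub_lt`).
This yields immediacy, and also uniqueness of the extension to `M_w`, because the approximant does
not depend on the extension. Relative separable closedness is a count of separable degrees
(`IsRelSepClosed.compositum`). -/

namespace ValuedFieldExt

open Polynomial

/-! ### Spherically complete modules and their permanence properties -/

section SphericallyComplete

/-- An `R`-module is spherically complete if every chain of cosets of submodules has a common
point. -/
def IsSphericallyComplete (R E : Type*) [Ring R] [AddCommGroup E] [Module R E] : Prop :=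
  ∀ S : Set (Set E), (∀ B ∈ S, ∃ (c : E) (I : Submodule R E), ∀ x, x ∈ B ↔ x - c ∈ I) →
    IsChain (· ⊆ ·) S → (⋂₀ S).Nonempty

variable {R R' E E' : Type*} [Ring R] [Ring R'] [AddCommGroup E] [AddCommGroup E'] [Module R E]

/-- Preimages of cosets are cosets. Semilinearity allows a change of scalars, needed to pass from
the valuation ring of `N_w` to that of `M_w`. -/
theorem IsSphericallyComplete.of_surjective [Module R' E'] {σ : R →+* R'} (φ : E →ₛₗ[σ] E')
    (hφ : Function.Surjective φ) (h : IsSphericallyComplete R E) :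
    IsSphericallyComplete R' E' := by
  intro S hS hc
  obtain ⟨x, hx⟩ := h ((φ ⁻¹' ·) '' S) (by
      rintro _ ⟨B, hB, rfl⟩
      obtain ⟨c, I, hI⟩ := hS B hB
      obtain ⟨c, rfl⟩ := hφ c
      exact ⟨c, I.comap φ, by simp [hI]⟩)
    (hc.image_of_map_rel _ _ _ fun _ _ h => Set.preimage_mono h)
  exact ⟨φ x, fun B hB => hx _ ⟨B, hB, rfl⟩⟩

theorem mem_image_iff_sub_mem_map [Module R E'] (φ : E →ₗ[R] E') {B : Set E} {c : E}
    {I : Submodule R E} (hI : ∀ x, x ∈ B ↔ x - c ∈ I) (y : E') :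
    y ∈ φ '' B ↔ y - φ c ∈ I.map φ := by
  constructor
  · rintro ⟨x, hx, rfl⟩
    exact ⟨x - c, (hI x).1 hx, map_sub ..⟩
  · rintro ⟨x, hx, hxy⟩
    exact ⟨x + c, (hI _).2 (by simpa using hx), by rw [map_add, hxy, sub_add_cancel]⟩

theorem IsSphericallyComplete.of_injective [Module R E'] (φ : E →ₗ[R] E')
    (hφ : Function.Injective φ) (h : IsSphericallyComplete R E') :
    IsSphericallyComplete R E := by
  intro S hS hc
  obtain rfl | ⟨B₀, hB₀⟩ := S.eq_empty_or_nonempty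
  · exact ⟨0, by simp⟩
  obtain ⟨y, hy⟩ := h ((φ '' ·) '' S) (by
      rintro _ ⟨B, hB, rfl⟩
      obtain ⟨c, I, hI⟩ := hS B hB
      exact ⟨φ c, I.map φ, mem_image_iff_sub_mem_map φ hI⟩)
    (hc.image_of_map_rel _ _ _ fun _ _ h => Set.image_mono h)
  obtain ⟨x, -, rfl⟩ := hy _ ⟨B₀, hB₀, rfl⟩
  refine ⟨x, fun B hB => ?_⟩
  obtain ⟨x', hx', h⟩ := hy _ ⟨B, hB, rfl⟩
  rwa [← hφ h]

/-- A common point `b` of the second projections is found first; the fibres over `b` are then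
nonempty cosets in the first factor and again form a chain. -/
theorem IsSphericallyComplete.prod [Module R E'] (h : IsSphericallyComplete R E)
    (h' : IsSphericallyComplete R E') : IsSphericallyComplete R (E × E') := by
  intro S hS hc
  obtain ⟨b, hb⟩ := h' ((LinearMap.snd R E E' '' ·) '' S) (by
      rintro _ ⟨B, hB, rfl⟩
      obtain ⟨c, I, hI⟩ := hS B hB
      exact ⟨_, _, mem_image_iff_sub_mem_map (LinearMap.snd R E E') hI⟩)
    (hc.image_of_map_rel _ _ _ fun _ _ h => Set.image_mono h)
  obtain ⟨a, ha⟩ := h ((((·, b) : E → E × E') ⁻¹' ·) '' S) (by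
      rintro _ ⟨B, hB, rfl⟩
      obtain ⟨⟨a₀, _⟩, ha₀, rfl⟩ := hb _ ⟨B, hB, rfl⟩
      obtain ⟨c, I, hI⟩ := hS B hB
      refine ⟨a₀, I.comap (LinearMap.inl R E E'), fun a => ?_⟩
      rw [hI] at ha₀
      simp only [Set.mem_preimage, Submodule.mem_comap, LinearMap.inl_apply, hI]
      rw [← I.sub_mem_iff_left ha₀]
      simp)
    (hc.image_of_map_rel _ _ _ fun _ _ h => Set.preimage_mono h)
  exact ⟨(a, b), fun B hB => ha _ ⟨B, hB, rfl⟩⟩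

theorem IsSphericallyComplete.pi_fin (h : IsSphericallyComplete R E) (n : ℕ) :
    IsSphericallyComplete R (Fin n → E) := by
  induction n with
  | zero =>
    refine fun S hS _ => ⟨0, fun B hB => ?_⟩
    obtain ⟨c, I, hI⟩ := hS B hB
    rw [hI, Subsingleton.elim (0 - c) 0]
    exact I.zero_mem
  | succ n ih =>
    exact (h.prod ih).of_surjective (Fin.consLinearEquiv R fun _ : Fin (n + 1) => E).toLinearMap
      (LinearEquiv.surjective _)

end SphericallyComplete

/-! ### Immediate extensions as extensions in which every element can be approximated -/

section Immediate

universe u v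

variable {K : Type u} {L : Type v} [Field K] [Field L] [Algebra K L]
  {V : ValuationSubring K} {V' : ValuationSubring L}

theorem Extends.valuation_le_iff (h : Extends V V') (x y : K) :
    V'.valuation (algebraMap K L x) ≤ V'.valuation (algebraMap K L y) ↔
      V.valuation x ≤ V.valuation y := by
  obtain rfl | hy := eq_or_ne y 0
  · simp
  have hy' : algebraMap K L y ≠ 0 := by simpa
  have h1 : V'.valuation (algebraMap K L x) ≤ V'.valuation (algebraMap K L y) ↔
      V'.valuation (algebraMap K L (x / y)) ≤ 1 := by
    rw [map_div₀, map_div₀, div_le_one₀ (by simpa [zero_lt_iff] using hy)]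
  have h2 : V.valuation x ≤ V.valuation y ↔ V.valuation (x / y) ≤ 1 := by
    rw [map_div₀, div_le_one₀ (by simpa [zero_lt_iff] using hy)]
  rw [h1, h2, V.valuation_le_one_iff, V'.valuation_le_one_iff, h.mem_iff]

theorem Extends.valuation_lt_iff (h : Extends V V') (x y : K) :
    V'.valuation (algebraMap K L x) < V'.valuation (algebraMap K L y) ↔
      V.valuation x < V.valuation y := by
  rw [← not_le, ← not_le, h.valuation_le_iff]

theorem Extends.valuation_eq_iff (h : Extends V V') (x y : K) :
    V'.valuation (algebraMap K L x) = V'.valuation (algebraMap K L y) ↔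
      V.valuation x = V.valuation y := by
  rw [le_antisymm_iff, le_antisymm_iff, h.valuation_le_iff, h.valuation_le_iff]

theorem Extends.residueMap_residue (h : Extends V V') (x : V) :
    h.residueMap (IsLocalRing.residue V x) = IsLocalRing.residue V' (h.ringMap x) := rfl

theorem residue_eq_iff (x y : V) :
    IsLocalRing.residue V x = IsLocalRing.residue V y ↔ V.valuation (x - y : K) < 1 := by
  rw [← sub_eq_zero, ← map_sub, IsLocalRing.residue_eq_zero_iff, V.valuation_lt_one_iff]
  rfl

/-- Equality of value groups gives `c` with the value of `z`; equality of residue fields then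
approximates the unit `z / c`. -/
theorem IsImmediate.exists_sub_lt (h : IsImmediate V V') {z : L} (hz : z ≠ 0) :
    ∃ a : K, V'.valuation (z - algebraMap K L a) < V'.valuation z := by
  obtain ⟨hE, hv, hr⟩ := h
  have hu : Units.map (V'.valuation : L →* V'.ValueGroup) (Units.mk0 z hz) ∈
    valueSubgroup K V' := hv ▸ Subgroup.mem_top _
  obtain ⟨c, hc⟩ := hu
  have hc' : V'.valuation (algebraMap K L c) = V'.valuation z := congrArg Units.val hc
  have hc0 : algebraMap K L c ≠ 0 := by simp
  have hvc : 0 < V'.valuation (algebraMap K L c) := by simp [zero_lt_iff]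
  have hz' : z / algebraMap K L c ∈ V' := by
    rw [← V'.valuation_le_one_iff, map_div₀, hc', div_self (by simpa using hz)]
  obtain ⟨r, hr⟩ := hr (IsLocalRing.residue V' ⟨_, hz'⟩)
  obtain ⟨a, rfl⟩ := IsLocalRing.residue_surjective r
  rw [hE.residueMap_residue, eq_comm, residue_eq_iff] at hr
  refine ⟨c * a, ?_⟩
  change V'.valuation (z / algebraMap K L c - algebraMap K L a) < 1 at hr
  calc _ = V'.valuation (algebraMap K L c) *
        V'.valuation (z / algebraMap K L c - algebraMap K L a) := by
        rw [← map_mul, mul_sub, mul_div_cancel₀ _ hc0, map_mul]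
    _ < V'.valuation (algebraMap K L c) := mul_lt_of_lt_one_right hvc hr
    _ = _ := hc'

theorem isImmediate_of_exists_sub_lt (h : Extends V V')
    (H : ∀ z : L, z ≠ 0 → ∃ a : K, V'.valuation (z - algebraMap K L a) < V'.valuation z) :
    IsImmediate V V' := by
  refine ⟨h, ?_, ?_⟩
  · rw [eq_top_iff]
    rintro γ -
    obtain ⟨z, hz⟩ := V'.valuation_surjective γ
    have hz0 : z ≠ 0 := by
      rintro rfl
      exact γ.ne_zero (by rw [← hz, map_zero])
    obtain ⟨a, ha⟩ := H z hz0
    have hva : V'.valuation (algebraMap K L a) = V'.valuation z := by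
      simpa using V'.valuation.map_sub_eq_of_lt_right ha
    have ha0 : a ≠ 0 := by
      rintro rfl
      rw [map_zero, map_zero] at hva
      exact hz0 (V'.valuation.zero_iff.1 hva.symm)
    exact ⟨Units.mk0 a ha0, Units.ext (hva.trans hz)⟩
  · intro r
    obtain ⟨z, rfl⟩ := IsLocalRing.residue_surjective r
    by_cases hz : (z : L) = 0
    · exact ⟨0, by rw [map_zero, show z = 0 from Subtype.ext hz, map_zero]⟩
    obtain ⟨a, ha⟩ := H z hz
    have hva : V'.valuation (algebraMap K L a) = V'.valuation z := by
      simpa using V'.valuation.map_sub_eq_of_lt_right ha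
    have haV : a ∈ V := by
      rw [← h.mem_iff, ← V'.valuation_le_one_iff, hva]
      exact V'.valuation_le_one z
    refine ⟨IsLocalRing.residue V ⟨a, haV⟩, ?_⟩
    rw [h.residueMap_residue, eq_comm, residue_eq_iff]
    exact ha.trans_le (V'.valuation_le_one z)

/-- A common point of the balls around `x`, traced on `K`, would be a best approximation of `x` from
`K`, whereas in an immediate extension every approximation of an element outside `K` can be
improved. -/
theorem IsSphericallyComplete.isMaximal (hV : IsSphericallyComplete V K) : IsMaximal V := by
  intro F _ _ V' hi x
  by_contra hx
  have hE := hi.1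
  let I (a : K) : Submodule V K :=
    { carrier := {y | V'.valuation (algebraMap K F y) ≤ V'.valuation (x - algebraMap K F a)}
      add_mem' := fun {y z} hy hz => by
        rw [Set.mem_ofPred_eq, map_add]
        exact V'.valuation.map_add_le hy hz
      zero_mem' := by simp
      smul_mem' := fun c y hy => by
        have : V'.valuation (algebraMap K F c) ≤ 1 := by
          rw [V'.valuation_le_one_iff, hE.mem_iff]
          exact c.2
        rw [Set.mem_ofPred_eq, Algebra.smul_def, map_mul, map_mul]
        exact (mul_le_of_le_one_left' this).trans hy }
  have hI (a y : K) : y - a ∈ I a ↔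
      V'.valuation (x - algebraMap K F y) ≤ V'.valuation (x - algebraMap K F a) := by
    have h1 : y - a ∈ I a ↔
      V'.valuation (algebraMap K F (y - a)) ≤ V'.valuation (x - algebraMap K F a) := Iff.rfl
    rw [h1]
    constructor
    · intro h
      rw [show x - algebraMap K F y = (x - algebraMap K F a) - algebraMap K F (y - a) by
        rw [map_sub]; ring]
      exact V'.valuation.map_sub_le le_rfl h
    · intro h
      rw [show algebraMap K F (y - a) = (x - algebraMap K F a) - (x - algebraMap K F y) by
        rw [map_sub]; ring]
      exact V'.valuation.map_sub_le le_rfl h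
  obtain ⟨a, ha⟩ := hV (Set.range fun a => {y | y - a ∈ I a})
    (by rintro _ ⟨a, rfl⟩; exact ⟨a, I a, fun _ => Iff.rfl⟩) (by
      rintro _ ⟨a, rfl⟩ _ ⟨b, rfl⟩ -
      rcases le_total (V'.valuation (x - algebraMap K F a))
        (V'.valuation (x - algebraMap K F b)) with h | h
      · exact Or.inl fun y hy => (hI _ _).2 (((hI _ _).1 hy).trans h)
      · exact Or.inr fun y hy => (hI _ _).2 (((hI _ _).1 hy).trans h))
  obtain ⟨b, hb⟩ := hi.exists_sub_lt (z := x - algebraMap K F a) fun h =>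
    hx ⟨a, (sub_eq_zero.1 h).symm⟩
  have := (hI _ _).1 (ha _ ⟨a + b, rfl⟩)
  rw [sub_sub, ← map_add] at hb
  exact absurd this (not_le.2 hb)

end Immediate

/-! ### Values of polynomials along a pseudo-convergent filter -/

section Kaplansky

open Filter

universe u

variable {N : Type u} [Field N] {Γ : Type*} [LinearOrderedCommGroupWithZero Γ]
  {v : Valuation N Γ} {l : Filter N} {f g h : N[X]} {γ : Γ}

/-- The value of the polynomial is constant along the filter. -/
def IsStable (v : Valuation N Γ) (l : Filter N) (g : N[X]) : Prop :=
  ∃ γ, ∀ᶠ b in l, v (g.eval b) = γ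

open Classical in
/-- The eventual value of a polynomial along a filter. -/
noncomputable def stableValue (v : Valuation N Γ) (l : Filter N) (g : N[X]) : Γ :=
  if hg : IsStable v l g then hg.choose else 0

theorem IsStable.eventually (hg : IsStable v l g) :
    ∀ᶠ b in l, v (g.eval b) = stableValue v l g := by
  rw [stableValue, dif_pos hg]
  exact hg.choose_spec

theorem stableValue_eq [l.NeBot] (hg : ∀ᶠ b in l, v (g.eval b) = γ) :
    stableValue v l g = γ := by
  obtain ⟨b, h1, h2⟩ := (hg.and (IsStable.eventually ⟨γ, hg⟩)).exists
  exact h2.symm.trans h1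

theorem isStable_C (c : N) : IsStable v l (C c) := ⟨v c, by simp⟩

theorem stableValue_C [l.NeBot] (c : N) : stableValue v l (C c) = v c :=
  stableValue_eq (by simp)

theorem IsStable.mul (hg : IsStable v l g) (hh : IsStable v l h) : IsStable v l (g * h) :=
  ⟨_, by
    filter_upwards [hg.eventually, hh.eventually] with b h1 h2
    rw [eval_mul, map_mul, h1, h2]⟩

theorem stableValue_mul [l.NeBot] (hg : IsStable v l g) (hh : IsStable v l h) :
    stableValue v l (g * h) = stableValue v l g * stableValue v l h :=
  stableValue_eq <| by
    filter_upwards [hg.eventually, hh.eventually] with b h1 h2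
    rw [eval_mul, map_mul, h1, h2]

theorem stableValue_add_le [l.NeBot] (hg : IsStable v l g) (hh : IsStable v l h)
    (hgh : IsStable v l (g + h)) :
    stableValue v l (g + h) ≤ max (stableValue v l g) (stableValue v l h) := by
  obtain ⟨b, h1, h2, h3⟩ := (hg.eventually.and (hh.eventually.and hgh.eventually)).exists
  rw [← h1, ← h2, ← h3, eval_add]
  exact v.map_add _ _

/-- The filter is pseudo-convergent without a limit in the field: every element can be improved as
an approximation. -/
def IsPseudoCauchy (v : Valuation N Γ) (l : Filter N) : Prop :=
  ∀ a, ∀ᶠ b in l, ∀ᶠ c in l, v (c - b) < v (c - a)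

variable [l.NeBot]

theorem IsPseudoCauchy.isStable_X_sub_C (H : IsPseudoCauchy v l) (a : N) :
    IsStable v l (X - C a) := by
  obtain ⟨b, hb⟩ := (H a).exists
  refine ⟨v (b - a), hb.mono fun c hc => ?_⟩
  have := v.map_sub_eq_of_lt_right hc
  rw [eval_sub, eval_X, eval_C, ← this, ← v.map_neg]
  congr 1
  ring

theorem IsPseudoCauchy.eventually_ne (H : IsPseudoCauchy v l) (a : N) : ∀ᶠ b in l, b ≠ a := by
  obtain ⟨b, hb⟩ := (H a).exists
  refine hb.mono fun c hc => ?_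
  rintro rfl
  simp at hc

theorem IsPseudoCauchy.eventually_eval_ne_zero (H : IsPseudoCauchy v l) (hg : g ≠ 0) :
    ∀ᶠ b in l, g.eval b ≠ 0 := by
  classical
  have : ∀ᶠ b in l, ∀ a ∈ g.roots.toFinset, b ≠ a :=
    (Finset.eventually_all _).2 fun a _ => H.eventually_ne a
  refine this.mono fun b hb h0 => hb b ?_ rfl
  simpa [hg] using h0

theorem IsPseudoCauchy.stableValue_ne_zero (H : IsPseudoCauchy v l) (hg : IsStable v l g)
    (h0 : g ≠ 0) : stableValue v l g ≠ 0 := by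
  obtain ⟨b, h1, h2⟩ := (hg.eventually.and (H.eventually_eval_ne_zero h0)).exists
  rw [← h1]
  exact v.ne_zero_iff.2 h2

theorem IsPseudoCauchy.eventually_stableValue_lt (H : IsPseudoCauchy v l) (a : N) :
    ∀ᶠ b in l, stableValue v l (X - C b) < stableValue v l (X - C a) := by
  refine (H a).mono fun b hb => ?_
  obtain ⟨c, h1, h2, h3⟩ := (hb.and ((H.isStable_X_sub_C a).eventually.and
    (H.isStable_X_sub_C b).eventually)).exists
  rw [← h2, ← h3]
  simpa using h1

theorem eval_sub_eval_eq_sum (g : N[X]) (a b : N) :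
    g.eval b - g.eval a =
      ∑ i ∈ Finset.Icc 1 g.natDegree, (hasseDeriv i g).eval a * (b - a) ^ i := by
  have h1 : g.eval b = (taylor a g).eval (b - a) := by rw [taylor_eval, sub_add_cancel]
  rw [h1, eval_eq_sum_range, natDegree_taylor, Finset.sum_range_succ', taylor_coeff_zero]
  rw [pow_zero, mul_one, add_sub_cancel_right, Finset.range_eq_Ico,
    Finset.sum_Ico_add' (fun i => (taylor a g).coeff i * (b - a) ^ i)]
  simp only [taylor_coeff, zero_add]
  rfl

/-- Equality determines the power `stableValue v l (X - C a) ^ (j - i)`, so it can hold for only one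
value of `X - C a`; along the filter these values drop strictly below any given one. -/
theorem IsPseudoCauchy.eventually_mul_pow_ne (H : IsPseudoCauchy v l) {β β' : Γ} (hβ : β ≠ 0)
    {i j : ℕ} (hij : i < j) :
    ∀ᶠ a in l, β * stableValue v l (X - C a) ^ i ≠ β' * stableValue v l (X - C a) ^ j := by
  have hne (a : N) : stableValue v l (X - C a) ≠ 0 :=
    H.stableValue_ne_zero (H.isStable_X_sub_C a) (X_sub_C_ne_zero a)
  have key (a : N) (ha : β * stableValue v l (X - C a) ^ i = β' * stableValue v l (X - C a) ^ j) :
      β = β' * stableValue v l (X - C a) ^ (j - i) := by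
    rw [← Nat.sub_add_cancel hij.le, pow_add, ← mul_assoc] at ha
    exact mul_right_cancel₀ (pow_ne_zero i (hne a)) ha
  by_cases hex : ∃ a, β * stableValue v l (X - C a) ^ i = β' * stableValue v l (X - C a) ^ j
  · obtain ⟨a, ha⟩ := hex
    refine (H.eventually_stableValue_lt a).mono fun b hb heq => ?_
    have h1 := key a ha
    rw [key b heq] at h1
    have hβ' : 0 < β' := by
      rw [zero_lt_iff]
      rintro rfl
      exact hβ (by simpa using key a ha)
    have h2 := mul_left_cancel₀ hβ'.ne' h1
    exact (pow_lt_pow_left₀ hb zero_le (Nat.sub_ne_zero_of_lt hij)).ne h2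
  · push Not at hex
    exact Eventually.of_forall hex

/-- A polynomial whose Hasse derivatives have eventually constant value is approximated, along the
filter, by its values. -/
theorem IsPseudoCauchy.exists_eventually_sub_lt (H : IsPseudoCauchy v l) (hg0 : g ≠ 0)
    (hg : ∀ i, IsStable v l (hasseDeriv i g)) :
    ∃ a, ∀ᶠ b in l, v (g.eval b - g.eval a) < v (g.eval b) := by
  have hg' : IsStable v l g := by simpa using hg 0
  set n := g.natDegree with hn
  obtain hn0 | hn0 := Nat.eq_zero_or_pos n
  · rw [eq_C_of_natDegree_eq_zero hn0] at hg0 ⊢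
    refine ⟨0, Eventually.of_forall fun b => ?_⟩
    simpa [zero_lt_iff] using hg0
  set β : ℕ → Γ := fun i => stableValue v l (hasseDeriv i g) with hβ
  set ρ : N → Γ := fun a => stableValue v l (X - C a) with hρ
  have hρ0 (a : N) : 0 < ρ a := zero_lt_iff.2 <|
    H.stableValue_ne_zero (H.isStable_X_sub_C a) (X_sub_C_ne_zero a)
  have hβn : β n ≠ 0 := by
    rw [hβ, hn]
    simp only [hasseDeriv_natDegree_eq_C, stableValue_C]
    simpa using hg0
  have hP1 : ∀ᶠ a in l, ∀ i ∈ Finset.Icc 1 n, v ((hasseDeriv i g).eval a) = β i :=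
    (Finset.eventually_all _).2 fun i _ => (hg i).eventually
  have hP2 : ∀ᶠ a in l, ∀ i ∈ Finset.Icc 1 n, ∀ j ∈ Finset.Icc 1 n, i < j → β i ≠ 0 →
      β i * ρ a ^ i ≠ β j * ρ a ^ j := by
    simp only [Finset.eventually_all, eventually_imp_distrib_left]
    exact fun i _ j _ hij hi => H.eventually_mul_pow_ne hi hij
  -- Once the Taylor terms at `a` have distinct nonzero values, a single index `k` dominates and
  -- determines the value of the difference.
  have hδ (a : N) (h1 : ∀ i ∈ Finset.Icc 1 n, v ((hasseDeriv i g).eval a) = β i)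
      (h2 : ∀ i ∈ Finset.Icc 1 n, ∀ j ∈ Finset.Icc 1 n, i < j → β i ≠ 0 →
        β i * ρ a ^ i ≠ β j * ρ a ^ j) :
      ∃ k ∈ Finset.Icc 1 n, β k ≠ 0 ∧ (∀ j ∈ Finset.Icc 1 n, β j * ρ a ^ j ≤ β k * ρ a ^ k) ∧
        ∀ᶠ b in l, v (g.eval b - g.eval a) = β k * ρ a ^ k := by
    obtain ⟨k, hk, hmax⟩ := (Finset.Icc 1 n).exists_max_image (fun i => β i * ρ a ^ i)
      ⟨n, by simp; omega⟩
    have hpos : 0 < β k * ρ a ^ k :=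
      (mul_pos (zero_lt_iff.2 hβn) (pow_pos (hρ0 a) n)).trans_le (hmax n (by simp; omega))
    have hβk : β k ≠ 0 := left_ne_zero_of_mul hpos.ne'
    refine ⟨k, hk, hβk, hmax, (H.isStable_X_sub_C a).eventually.mono fun b hb => ?_⟩
    have hterm (i) (hi : i ∈ Finset.Icc 1 n) :
        v ((hasseDeriv i g).eval a * (b - a) ^ i) = β i * ρ a ^ i := by
      rw [map_mul, map_pow, h1 i hi, ← show v (b - a) = ρ a by simpa using hb]
    rw [eval_sub_eval_eq_sum, ← hn, ← hterm k hk]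
    refine v.map_sum_eq_of_lt hk fun i hi => ?_
    · rw [Finset.mem_sdiff, Finset.mem_singleton] at hi
      rw [hterm k hk, hterm i hi.1]
      refine (hmax i hi.1).lt_of_ne fun heq => ?_
      rcases lt_or_gt_of_ne hi.2 with hlt | hlt
      · refine h2 i hi.1 k hk hlt ?_ heq
        exact left_ne_zero_of_mul (heq ▸ hpos.ne')
      · exact h2 k hk i hi.1 hlt hβk heq.symm
  -- Two centres are needed: at `a₁` the difference has value at most that of `g`, and moving to the
  -- closer centre `a₂` makes it strictly smaller.
  obtain ⟨a₁, ⟨⟨h11, h12⟩, ha₁⟩⟩ := ((hP1.and hP2).and hg'.eventually).exists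
  obtain ⟨a₂, ⟨h21, h22⟩, hlt⟩ := ((hP1.and hP2).and (H.eventually_stableValue_lt a₁)).exists
  obtain ⟨k₁, -, -, hmax, hk₁⟩ := hδ a₁ h11 h12
  obtain ⟨k₂, hk₂', hβk, -, hk₂⟩ := hδ a₂ h21 h22
  refine ⟨a₂, ?_⟩
  filter_upwards [hk₁, hk₂, hg'.eventually] with b hb₁ hb₂ hb₃
  calc v (g.eval b - g.eval a₂) = β k₂ * ρ a₂ ^ k₂ := hb₂
    _ < β k₂ * ρ a₁ ^ k₂ := by
      refine mul_lt_mul_of_pos_left (pow_lt_pow_left₀ hlt zero_le ?_) (zero_lt_iff.2 hβk)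
      have := (Finset.mem_Icc.1 hk₂').1
      omega
    _ ≤ β k₁ * ρ a₁ ^ k₁ := hmax _ hk₂'
    _ = v (g.eval b - g.eval a₁) := hb₁.symm
    _ ≤ v (g.eval b) := v.map_sub_le le_rfl (by rw [ha₁, hb₃])

end Kaplansky

/-! ### Kaplansky's theorem: maximal fields are spherically complete -/

section MaximalSphericallyComplete

open Filter

universe u

variable {N : Type u} [Field N]

theorem exists_sub_lt_mul {F : Type*} [Field F] [Algebra N F] {Γ : Type*}
    [LinearOrderedCommGroupWithZero Γ] {w : Valuation F Γ} {z y : F} {a b : N}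
    (hz : w (z - algebraMap N F a) < w z) (hy : w (y - algebraMap N F b) < w y) :
    w (z * y - algebraMap N F (a * b)) < w (z * y) := by
  have ha : w (algebraMap N F a) = w z := by simpa using w.map_sub_eq_of_lt_right hz
  have hz0 : 0 < w z := zero_le.trans_lt hz
  have hy0 : 0 < w y := zero_le.trans_lt hy
  rw [show z * y - algebraMap N F (a * b) =
    (z - algebraMap N F a) * y + algebraMap N F a * (y - algebraMap N F b) by
      rw [map_mul]; ring, map_mul w z y]
  refine w.map_add_lt ?_ ?_
  · rw [map_mul]
    exact mul_lt_mul_of_pos_right hz hy0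
  · rw [map_mul, ha]
    exact mul_lt_mul_of_pos_left hy hz0

theorem exists_sub_lt_inv {F : Type*} [Field F] [Algebra N F] {Γ : Type*}
    [LinearOrderedCommGroupWithZero Γ] {w : Valuation F Γ} {z : F} {a : N}
    (hz : w (z - algebraMap N F a) < w z) :
    w (z⁻¹ - algebraMap N F a⁻¹) < w z⁻¹ := by
  have ha : w (algebraMap N F a) = w z := by simpa using w.map_sub_eq_of_lt_right hz
  have hz0 : 0 < w z := zero_le.trans_lt hz
  have h1 : z ≠ 0 := w.ne_zero_iff.1 hz0.ne'
  have h2 : algebraMap N F a ≠ 0 := w.ne_zero_iff.1 (ha ▸ hz0.ne')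
  rw [show z⁻¹ - algebraMap N F a⁻¹ = -((z - algebraMap N F a) * (z⁻¹ * (algebraMap N F a)⁻¹)) by
    rw [map_inv₀]; field_simp; ring, w.map_neg, map_mul, map_mul, map_inv₀, map_inv₀, ha]
  calc _ < w z * ((w z)⁻¹ * (w z)⁻¹) := mul_lt_mul_of_pos_right hz
        (mul_pos (inv_pos.2 hz0) (inv_pos.2 hz0))
    _ = (w z)⁻¹ := by rw [← mul_assoc, mul_inv_cancel₀ hz0.ne', one_mul]

theorem not_isMaximal_of_valuation {V : ValuationSubring N} {F : Type u} [Field F] [Algebra N F]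
    (w : Valuation F V.ValueGroup) (hw : ∀ a, w (algebraMap N F a) = V.valuation a)
    (H : ∀ z : F, z ≠ 0 → ∃ a : N, w (z - algebraMap N F a) < w z) {x : F}
    (hx : ∀ a, x ≠ algebraMap N F a) : ¬ IsMaximal V := by
  intro hV
  obtain ⟨a, ha⟩ := hV F w.valuationSubring (isImmediate_of_exists_sub_lt (by
    ext a
    rw [ValuationSubring.mem_comap, Valuation.mem_valuationSubring_iff, hw,
      V.valuation_le_one_iff]) fun z hz => by
    obtain ⟨a, ha⟩ := H z hz
    exact ⟨a, w.isEquiv_valuation_valuationSubring.lt_iff_lt.1 ha⟩) x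
  exact hx a ha.symm

section

variable {V : ValuationSubring N} {l : Filter N} [l.NeBot]

theorem IsPseudoCauchy.exists_stableValue_sub_lt (H : IsPseudoCauchy V.valuation l) {g : N[X]}
    (hg0 : g ≠ 0) (hg : ∀ h : N[X], h.natDegree ≤ g.natDegree → IsStable V.valuation l h) :
    ∃ a, stableValue V.valuation l (g - C a) < stableValue V.valuation l g := by
  obtain ⟨a, ha⟩ := H.exists_eventually_sub_lt hg0 fun i =>
    hg _ ((natDegree_hasseDeriv_le g i).trans (Nat.sub_le ..))
  refine ⟨g.eval a, ?_⟩
  obtain ⟨b, h1, h2, h3⟩ := (ha.and ((hg g le_rfl).eventually.and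
    (hg (g - C (g.eval a)) (natDegree_sub_C.le)).eventually)).exists
  rw [← h2, ← h3]
  simpa using h1

/-- The valuation on polynomials given by the eventual values. -/
noncomputable def stableValuation (hall : ∀ g, IsStable V.valuation l g) :
    Valuation N[X] V.ValueGroup where
  toFun := stableValue V.valuation l
  map_zero' := by simpa using stableValue_C (v := V.valuation) (l := l) (0 : N)
  map_one' := by simpa using stableValue_C (v := V.valuation) (l := l) (1 : N)
  map_mul' g h := stableValue_mul (hall g) (hall h)
  map_add_le_max' g h := stableValue_add_le (hall g) (hall h) (hall _)

/-- The transcendental case: eventual values define a valuation on `N(X)` in which `X` is a limit of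
the filter. Polynomials are approximated by constants, hence so are their quotients. -/
theorem IsPseudoCauchy.not_isMaximal_of_forall_isStable (H : IsPseudoCauchy V.valuation l)
    (hall : ∀ g, IsStable V.valuation l g) : ¬ IsMaximal V := by
  have hS : nonZeroDivisors N[X] ≤ (stableValuation hall).supp.primeCompl := fun g hg h0 =>
    H.stableValue_ne_zero (hall g) (nonZeroDivisors.ne_zero hg) h0
  set w := (stableValuation hall).extendToLocalization hS (FractionRing N[X]) with hw
  have hwp (g : N[X]) : w (algebraMap _ _ g) = stableValue V.valuation l g :=
    (stableValuation hall).extendToLocalization_apply_map_apply hS _ g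
  have hwC (a : N) (g : N[X]) :
      w (algebraMap _ _ g - algebraMap N _ a) = stableValue V.valuation l (g - C a) := by
    rw [← hwp, (algebraMap N[X] (FractionRing N[X])).map_sub,
      IsScalarTower.algebraMap_apply N N[X] (FractionRing N[X]) a,
      algebraMap_eq]
  refine not_isMaximal_of_valuation w (fun a => ?_) (fun z hz => ?_)
    (x := algebraMap N[X] _ X) fun a ha => ?_
  · rw [IsScalarTower.algebraMap_apply N N[X] (FractionRing N[X]), hwp, algebraMap_eq,
      stableValue_C]
  · obtain ⟨g, h, hh, rfl⟩ := IsFractionRing.div_surjective (A := N[X]) z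
    have hg0 : g ≠ 0 := by
      rintro rfl
      simp at hz
    obtain ⟨a, ha⟩ := H.exists_stableValue_sub_lt hg0 fun h _ => hall h
    obtain ⟨b, hb⟩ := H.exists_stableValue_sub_lt (nonZeroDivisors.ne_zero hh) fun h _ => hall h
    rw [← hwC, ← hwp] at ha hb
    exact ⟨a * b⁻¹, by
      rw [div_eq_mul_inv]; exact exists_sub_lt_mul ha (exists_sub_lt_inv hb)⟩
  · refine H.stableValue_ne_zero (H.isStable_X_sub_C a) (X_sub_C_ne_zero a) ?_
    rw [← hwC, ha, sub_self, map_zero]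

/-- If the two values differed, `f` times the quotient would have eventually constant value. The
quotient has degree below that of `f` and is stable, so `f` would be stable too. -/
theorem stableValue_modByMonic {f : N[X]}
    (hf : f.Monic) (hfs : ¬ IsStable V.valuation l f)
    (hlt : ∀ g : N[X], g.degree < f.degree → IsStable V.valuation l g)
    {g h : N[X]} (hg : g.degree < f.degree) (hh : h.degree < f.degree) :
    stableValue V.valuation l ((g * h) %ₘ f) =
      stableValue V.valuation l g * stableValue V.valuation l h := by
  rw [← stableValue_mul (hlt g hg) (hlt h hh)]
  have hgh := (hlt g hg).mul (hlt h hh)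
  have hr := hlt _ (degree_modByMonic_lt (g * h) hf)
  by_contra hne
  have hq : IsStable V.valuation l ((g * h) /ₘ f) := by
    refine hlt _ ?_
    by_cases hq0 : (g * h) /ₘ f = 0
    · rw [hq0, degree_zero, bot_lt_iff_ne_bot]
      exact fun h => hf.ne_zero (degree_eq_bot.1 h)
    have hgh0 : g * h ≠ 0 := by
      intro h0
      simp [h0] at hq0
    have h1 := natDegree_divByMonic (g * h) hf
    have hg0 := left_ne_zero_of_mul hgh0
    have hh0 := right_ne_zero_of_mul hgh0
    rw [natDegree_mul hg0 hh0] at h1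
    have h2 := natDegree_lt_natDegree hg0 hg
    have h3 := natDegree_lt_natDegree hh0 hh
    rw [degree_eq_natDegree hq0, degree_eq_natDegree hf.ne_zero]
    exact_mod_cast (by omega : ((g * h) /ₘ f).natDegree < f.natDegree)
  have hval : ∀ᶠ b in l, V.valuation ((f * ((g * h) /ₘ f)).eval b) =
      max (stableValue V.valuation l (g * h)) (stableValue V.valuation l ((g * h) %ₘ f)) := by
    filter_upwards [hgh.eventually, hr.eventually] with b h1 h2
    rw [← h1, ← h2]
    rw [show f * ((g * h) /ₘ f) = g * h + -((g * h) %ₘ f) by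
      rw [modByMonic_eq_sub_mul_div]; ring, eval_add, eval_neg,
      V.valuation.map_add_of_distinct_val, V.valuation.map_neg]
    rw [V.valuation.map_neg, h1, h2]
    exact fun h => hne h.symm
  have hmax : max (stableValue V.valuation l (g * h))
      (stableValue V.valuation l ((g * h) %ₘ f)) ≠ 0 := by
    intro h0
    refine hne ?_
    rw [← le_zero_iff, max_le_iff, le_zero_iff, le_zero_iff] at h0
    rw [h0.1, h0.2]
  refine hfs ⟨max (stableValue V.valuation l (g * h)) (stableValue V.valuation l ((g * h) %ₘ f)) *
    (stableValue V.valuation l ((g * h) /ₘ f))⁻¹, ?_⟩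
  filter_upwards [hval, hq.eventually] with b h1 h2
  rw [← h1, ← h2, eval_mul, map_mul, mul_assoc, mul_inv_cancel₀, mul_one]
  intro h0
  rw [eval_mul, map_mul, h0, mul_zero] at h1
  exact hmax h1.symm

/-- The algebraic case: `f` is irreducible by minimality of its degree, and a class in `N[X]/(f)` is
given the eventual value of its representative of degree less than that of `f`. The root of `f`
becomes a limit outside `N`. -/
theorem IsPseudoCauchy.not_isMaximal_of_not_isStable (H : IsPseudoCauchy V.valuation l) {f : N[X]}
    (hf : f.Monic) (hfs : ¬ IsStable V.valuation l f)
    (hlt : ∀ g : N[X], g.degree < f.degree → IsStable V.valuation l g) : ¬ IsMaximal V := by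
  have hdeg : 1 < f.natDegree := by
    by_contra! h1
    rcases Nat.le_one_iff_eq_zero_or_eq_one.1 h1 with h0 | h0
    · rw [hf.natDegree_eq_zero.1 h0] at hfs
      exact hfs (isStable_C 1)
    · rw [hf.eq_X_add_C h0] at hfs
      exact hfs (by simpa using H.isStable_X_sub_C (-f.coeff 0))
  have hirr : Irreducible f := by
    rw [hf.irreducible_iff_natDegree]
    refine ⟨fun h => by simp [h] at hdeg, fun g h hg hh hgh => ?_⟩
    by_contra! hne
    have hadd := hg.natDegree_mul hh
    rw [hgh] at hadd
    refine hfs (hgh ▸ (hlt g ?_).mul (hlt h ?_))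
    · exact degree_lt_degree (by omega)
    · exact degree_lt_degree (by omega)
  have : Fact (Irreducible f) := ⟨hirr⟩
  set rep := AdjoinRoot.modByMonicHom hf with hrep
  have hrepdeg (z : AdjoinRoot f) : (rep z).degree < f.degree := by
    obtain ⟨g, rfl⟩ := AdjoinRoot.mk_surjective z
    rw [hrep, AdjoinRoot.modByMonicHom_mk]
    exact degree_modByMonic_lt g hf
  have hmk (z : AdjoinRoot f) : AdjoinRoot.mk f (rep z) = z := AdjoinRoot.mk_leftInverse hf z
  have hrep_of {g : N[X]} (hg : g.degree < f.degree) : rep (AdjoinRoot.mk f g) = g := by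
    rw [hrep, AdjoinRoot.modByMonicHom_mk, (modByMonic_eq_self_iff hf).2 hg]
  have hC (a : N) : (C a).degree < f.degree :=
    degree_C_le.trans_lt (natDegree_pos_iff_degree_pos.1 (by omega))
  have hX : (X : N[X]).degree < f.degree := by
    rw [degree_X, degree_eq_natDegree hf.ne_zero]
    exact_mod_cast hdeg
  have hrepC (a : N) : rep (algebraMap N _ a) = C a := hrep_of (hC a)
  let w : Valuation (AdjoinRoot f) V.ValueGroup :=
    { toFun := fun z => stableValue V.valuation l (rep z)
      map_zero' := by simpa using stableValue_C (v := V.valuation) (l := l) (0 : N)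
      map_one' := by
        rw [show (1 : AdjoinRoot f) = algebraMap N _ 1 from (map_one _).symm, hrepC, stableValue_C,
          map_one]
      map_mul' := fun z y => by
        rw [← stableValue_modByMonic hf hfs hlt (hrepdeg z) (hrepdeg y),
          ← AdjoinRoot.modByMonicHom_mk hf, (AdjoinRoot.mk f).map_mul, hmk, hmk]
      map_add_le_max' := fun z y => by
        rw [map_add]
        refine stableValue_add_le (hlt _ (hrepdeg z)) (hlt _ (hrepdeg y)) ?_
        rw [← map_add]
        exact hlt _ (hrepdeg _) }
  have hw (z : AdjoinRoot f) : w z = stableValue V.valuation l (rep z) := rfl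
  refine not_isMaximal_of_valuation w (fun a => ?_) (fun z hz => ?_)
    (x := AdjoinRoot.root f) fun a ha => ?_
  · rw [hw, hrepC, stableValue_C]
  · have hz0 : rep z ≠ 0 := fun h => hz (by rw [← hmk z, h, map_zero])
    obtain ⟨a, ha⟩ := H.exists_stableValue_sub_lt hz0 fun h hh => hlt _ <|
      degree_lt_degree (hh.trans_lt (natDegree_lt_natDegree hz0 (hrepdeg z)))
    refine ⟨a, ?_⟩
    rwa [hw, hw, map_sub, hrepC]
  · have h1 : rep (AdjoinRoot.root f) = X := hrep_of hX
    rw [ha, hrepC] at h1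
    exact X_ne_C a h1.symm

end

theorem IsMaximal.isSphericallyComplete {V : ValuationSubring N} (hV : IsMaximal V) :
    IsSphericallyComplete V N := by
  intro S hS hc
  by_contra hemp
  rw [Set.not_nonempty_iff_eq_empty] at hemp
  have hSne : S.Nonempty := by
    rw [Set.nonempty_iff_ne_empty]
    rintro rfl
    simp at hemp
  let l : Filter N := ⨅ B ∈ S, 𝓟 B
  have hbasis : l.HasBasis (· ∈ S) id :=
    hasBasis_biInf_principal (s := id) (fun A hA B hB => by
      rcases hc.total hA hB with h | h
      · exact ⟨A, hA, subset_rfl, h⟩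
      · exact ⟨B, hB, h, subset_rfl⟩) hSne
  have : l.NeBot := hbasis.neBot_iff.2 fun {B} hB => by
    obtain ⟨c, I, hI⟩ := hS B hB
    exact ⟨c, (hI c).2 (by simp)⟩
  -- Some coset `B` of the chain misses `a`. For `b` and `c` in `B`, a value of `c - a` not
  -- exceeding that of `c - b` would put `c - a` into the submodule, and hence `a` into `B`.
  have H : IsPseudoCauchy V.valuation l := fun a => by
    obtain ⟨B, hB, haB⟩ : ∃ B ∈ S, a ∉ B := by
      by_contra! h
      exact (Set.mem_empty_iff_false a).1 (hemp ▸ fun B hB => h B hB)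
    obtain ⟨c₀, I, hI⟩ := hS B hB
    have hBl : B ∈ l := hbasis.mem_of_mem hB
    filter_upwards [hBl] with b hb
    filter_upwards [hBl] with c hc
    by_contra! hle
    obtain ⟨r, hr⟩ := (V.valuation_le_iff _ _).1 hle
    refine haB ((hI a).2 ?_)
    rw [hI] at hb hc
    have h1 : c - b ∈ I := by simpa using I.sub_mem hc hb
    have h2 : c - a ∈ I := by
      rw [← hr]
      exact I.smul_mem r h1
    simpa using I.sub_mem hc h2
  by_cases hall : ∀ g, IsStable V.valuation l g
  · exact H.not_isMaximal_of_forall_isStable hall hV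
  · push Not at hall
    obtain ⟨f, hf, hmin⟩ := (InvImage.wf degree wellFounded_lt).has_min
      {g : N[X] | ¬ IsStable V.valuation l g} hall
    have hf0 : f ≠ 0 := by
      rintro rfl
      exact hf (by simpa using isStable_C (v := V.valuation) (l := l) (0 : N))
    refine H.not_isMaximal_of_not_isStable (monic_mul_leadingCoeff_inv hf0) (fun h => hf ?_)
      (fun g hg => ?_) hV
    · have := h.mul (isStable_C f.leadingCoeff)
      rwa [mul_assoc, ← C_mul, inv_mul_cancel₀ (leadingCoeff_ne_zero.2 hf0), C_1, mul_one] at this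
    · rw [degree_mul_leadingCoeff_inv _ hf0] at hg
      by_contra h
      exact hmin g h hg

end MaximalSphericallyComplete

/-! ### Hensel factorization over spherically complete local rings -/

section Hensel

open IsLocalRing

variable {R : Type*} [CommRing R]

theorem contentIdeal_le_iff_map_mk_eq_zero (p : R[X]) (J : Ideal R) :
    p.contentIdeal ≤ J ↔ p.map (Ideal.Quotient.mk J) = 0 := by
  constructor
  · intro h
    ext n
    rw [coeff_map, coeff_zero, Ideal.Quotient.eq_zero_iff_mem]
    exact h (coeff_mem_contentIdeal p n)
  · intro h
    rw [contentIdeal_def, Ideal.span_le]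
    intro x hx
    obtain ⟨n, -, rfl⟩ := mem_coeffs_iff.1 hx
    rw [SetLike.mem_coe, ← Ideal.Quotient.eq_zero_iff_mem, ← coeff_map, h, coeff_zero]

theorem contentIdeal_le_iff {p : R[X]} {J : Ideal R} :
    p.contentIdeal ≤ J ↔ ∀ n, p.coeff n ∈ J := by
  rw [contentIdeal_le_iff_map_mk_eq_zero, Polynomial.ext_iff]
  simp [Ideal.Quotient.eq_zero_iff_mem]

theorem contentIdeal_modByMonic_le_of_sub {f g h : R[X]} (hg : g.Monic) (hh : h.Monic)
    {J : Ideal R} (hf : (f %ₘ g).contentIdeal ≤ J) (hgh : (h - g).contentIdeal ≤ J) :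
    (f %ₘ h).contentIdeal ≤ J := by
  rw [contentIdeal_le_iff_map_mk_eq_zero] at *
  rw [Polynomial.map_sub, sub_eq_zero] at hgh
  rw [map_modByMonic _ hh, hgh, ← map_modByMonic _ hg, hf]

/-- The Newton step for the approximation of a monic factor. -/
theorem contentIdeal_modByMonic_add_le {f g : R[X]} (a : R) {J : Ideal R}
    (ha : (1 - C a * (f /ₘ g)).contentIdeal ≤ J) (hg' : (g + C a * (f %ₘ g)).Monic) :
    (f %ₘ (g + C a * (f %ₘ g))).contentIdeal ≤ J * (f %ₘ g).contentIdeal := by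
  set r := f %ₘ g with hr
  set q := f /ₘ g with hq
  -- Modulo `J` times the content of `r` the last summand vanishes, so there the corrected divisor
  -- divides `f`.
  have hf : f = (g + C a * r) * q + (1 - C a * q) * r := by
    rw [← modByMonic_add_div f g, ← hr, ← hq]
    ring
  have h1 : ((1 - C a * q) * r).contentIdeal ≤ J * r.contentIdeal :=
    (contentIdeal_mul_le_mul_contentIdeal _ _).trans (Ideal.mul_mono_left ha)
  rw [contentIdeal_le_iff_map_mk_eq_zero] at h1 ⊢
  rw [map_modByMonic _ hg', modByMonic_eq_zero_iff_dvd (hg'.map _)]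
  conv_rhs => rw [hf, Polynomial.map_add, h1, add_zero, Polynomial.map_mul]
  exact dvd_mul_right _ _

variable [IsLocalRing R]

/-- Newton approximation need not converge here, so limits are replaced by Zorn's lemma on balls of
candidate factors. At a minimal ball the Newton step gains nothing, and Nakayama's lemma shows that
the remainder vanishes. -/
theorem exists_monic_dvd_of_isSphericallyComplete (hR : IsSphericallyComplete R R) (f : R[X])
    (hf : f.map (residue R) ≠ 0) :
    ∃ g : R[X], g.Monic ∧ g.natDegree = (f.map (residue R)).natDegree ∧ g ∣ f := by
  set f' := f.map (residue R) with hf'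
  set d := f'.natDegree with hd
  set g' : (ResidueField R)[X] := f' * C f'.leadingCoeff⁻¹ with hg'
  have hg'm : g'.Monic := monic_mul_leadingCoeff_inv hf
  have hg'd : g'.natDegree = d := natDegree_mul_leadingCoeff_inv f' hf
  set G : Set R[X] := {g | g.Monic ∧ g.map (residue R) = g'} with hG
  have hGd {g : R[X]} (hg : g ∈ G) : g.natDegree = d := by
    rw [← hg'd, ← hg.2, hg.1.natDegree_map]
  have hGm {g : R[X]} (hg : g ∈ G) : (f %ₘ g).contentIdeal ≤ maximalIdeal R := by
    rw [contentIdeal_le_iff_map_mk_eq_zero]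
    change (f %ₘ g).map (residue R) = 0
    rw [map_modByMonic _ hg.1, hg.2, modByMonic_eq_zero_iff_dvd hg'm, hg',
      mul_comm, C_mul_dvd (inv_ne_zero (leadingCoeff_ne_zero.2 hf))]
  let P (y : Fin d → R) : R[X] := X ^ d + ∑ i : Fin d, C (y i) * X ^ (i : ℕ)
  have hPdeg (y : Fin d → R) : (∑ i : Fin d, C (y i) * X ^ (i : ℕ)).degree < (d : WithBot ℕ) :=
    degree_sum_fin_lt y
  have hPm (y : Fin d → R) : (P y).Monic := monic_X_pow_add (hPdeg y)
  have hPc (y : Fin d → R) (i : Fin d) : (P y).coeff i = y i := by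
    simp [P, coeff_X_pow, finsetSum_coeff, i.2.ne, Fin.val_inj]
  have hPnat (y : Fin d → R) : (P y).natDegree = d := by
    rw [natDegree_add_eq_left_of_degree_lt (by simpa using hPdeg y), natDegree_X_pow]
  have hcoeff {g h : R[X]} (hg : g.Monic) (hh : h.Monic) (hgd : g.natDegree = d)
      (hhd : h.natDegree = d) {J : Ideal R} (H : ∀ i : Fin d, h.coeff i - g.coeff i ∈ J) :
      (h - g).contentIdeal ≤ J := by
    refine contentIdeal_le_iff.2 fun n => ?_
    rw [coeff_sub]
    rcases lt_trichotomy n d with h1 | h1 | h1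
    · exact H ⟨n, h1⟩
    · have e1 : g.coeff n = 1 := by rw [h1, ← hgd]; exact hg
      have e2 : h.coeff n = 1 := by rw [h1, ← hhd]; exact hh
      simp [e1, e2]
    · rw [coeff_eq_zero_of_natDegree_lt (hgd.trans_lt h1),
        coeff_eq_zero_of_natDegree_lt (hhd.trans_lt h1)]
      simp
  -- The radius of the ball around `g` is the content ideal of the remainder, so the ball is a
  -- single point when `g` divides `f`.
  let B (g : R[X]) : Set (Fin d → R) :=
    {y | ∀ i : Fin d, y i - g.coeff i ∈ (f %ₘ g).contentIdeal}
  have hB (g : R[X]) (y : Fin d → R) :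
      y ∈ B g ↔ ∀ i : Fin d, y i - g.coeff i ∈ (f %ₘ g).contentIdeal := Iff.rfl
  have hBcoset (g : R[X]) (y : Fin d → R) : y ∈ B g ↔ y - (fun i : Fin d => g.coeff i) ∈
      Submodule.pi Set.univ (fun _ : Fin d => (f %ₘ g).contentIdeal) := by
    simp [hB]
  have hGP {g : R[X]} (hg : g ∈ G) {y : Fin d → R} (hy : y ∈ B g) :
      P y ∈ G ∧ B (P y) ⊆ B g := by
    have hsub : (P y - g).contentIdeal ≤ (f %ₘ g).contentIdeal :=
      hcoeff hg.1 (hPm y) (hGd hg) (hPnat y) fun i => by rw [hPc]; exact hy i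
    have hle := contentIdeal_modByMonic_le_of_sub hg.1 (hPm y) le_rfl hsub
    refine ⟨⟨hPm y, ?_⟩, fun z hz i => ?_⟩
    · rw [← hg.2, ← sub_eq_zero, ← Polynomial.map_sub]
      exact (contentIdeal_le_iff_map_mk_eq_zero _ _).1 (hsub.trans (hGm hg))
    · have := Ideal.add_mem _ (hle (hz i)) (hy i)
      rwa [hPc, sub_add_sub_cancel] at this
  obtain ⟨g₀, hg₀map, hg₀d, hg₀m⟩ :=
    lifts_and_natDegree_eq_and_monic (p := g') (f := residue R) (by
      rw [lifts_iff_coeff_lifts]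
      intro n
      exact residue_surjective _) hg'm
  obtain ⟨_, ⟨⟨g, hg, rfl⟩, hmin⟩⟩ := zorn_superset (B '' G) (by
    intro c hc hchain
    obtain rfl | hne := c.eq_empty_or_nonempty
    · exact ⟨_, ⟨g₀, ⟨hg₀m, hg₀map⟩, rfl⟩, by simp⟩
    obtain ⟨y, hy⟩ := hR.pi_fin d c (fun A hA => by
      obtain ⟨g, -, rfl⟩ := hc hA
      exact ⟨_, _, hBcoset g⟩) hchain
    refine ⟨B (P y), ⟨P y, ?_, rfl⟩, fun A hA => ?_⟩
    · obtain ⟨A, hA⟩ := hne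
      obtain ⟨g, hg, rfl⟩ := hc hA
      exact (hGP hg (hy _ hA)).1
    · obtain ⟨g, hg, rfl⟩ := hc hA
      exact (hGP hg (hy _ hA)).2)
  refine ⟨g, hg.1, hGd hg, ?_⟩
  rw [← modByMonic_eq_zero_iff_dvd hg.1, ← contentIdeal_eq_bot_iff]
  -- The quotient of `f` by `g` reduces to the constant `f'.leadingCoeff`, so a lift of its inverse
  -- is the right factor for the Newton correction.
  obtain ⟨a, ha⟩ := residue_surjective f'.leadingCoeff⁻¹
  have hmf : (1 - C a * (f /ₘ g)).contentIdeal ≤ maximalIdeal R := by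
    rw [contentIdeal_le_iff_map_mk_eq_zero]
    change (1 - C a * (f /ₘ g)).map (residue R) = 0
    have hq : (f /ₘ g).map (residue R) = C f'.leadingCoeff := by
      rw [(map_mod_divByMonic _ hg.1).1, hg.2, ← hf']
      have : f' = g' * C f'.leadingCoeff := by
        rw [hg', mul_assoc, ← C_mul, inv_mul_cancel₀ (leadingCoeff_ne_zero.2 hf), C_1, mul_one]
      conv_lhs => rw [this]
      exact mul_divByMonic_cancel_left _ hg'm
    rw [Polynomial.map_sub, Polynomial.map_mul, hq, Polynomial.map_one, map_C, ha, ← C_mul,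
      inv_mul_cancel₀ (leadingCoeff_ne_zero.2 hf), C_1, sub_self]
  have hdlt : (C a * (f %ₘ g)).degree < g.degree :=
    (by rw [← smul_eq_C_mul]; exact degree_smul_le a _ : _ ≤ (f %ₘ g).degree).trans_lt
      (degree_modByMonic_lt f hg.1)
  have hm' : (g + C a * (f %ₘ g)).Monic := hg.1.add_of_left hdlt
  have hstep := contentIdeal_modByMonic_add_le a hmf hm'
  have hG' : g + C a * (f %ₘ g) ∈ G := by
    refine ⟨hm', ?_⟩
    have h0 : (f %ₘ g).map (residue R) = 0 := (contentIdeal_le_iff_map_mk_eq_zero _ _).1 (hGm hg)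
    rw [Polynomial.map_add, hg.2, Polynomial.map_mul, h0, mul_zero, add_zero]
  have hlesub : (f %ₘ (g + C a * (f %ₘ g))).contentIdeal ≤ (f %ₘ g).contentIdeal :=
    hstep.trans Ideal.mul_le_right
  have hBsub : B (g + C a * (f %ₘ g)) ⊆ B g := fun y hy i => by
    have h1 := hlesub (hy i)
    have h2 : a * (f %ₘ g).coeff i ∈ (f %ₘ g).contentIdeal :=
      Ideal.mul_mem_left _ _ (coeff_mem_contentIdeal _ _)
    have := Ideal.add_mem _ h1 h2
    rwa [coeff_add, coeff_C_mul, sub_add_eq_sub_sub, sub_add_cancel] at this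
  -- By minimality `g` lies in the ball of its own correction. The difference of the two is a unit
  -- times the remainder, so the content of the remainder is contained in its product with the
  -- maximal ideal.
  have hBge := hmin ⟨_, hG', rfl⟩ hBsub
  have hgB : (fun i : Fin d => g.coeff i) ∈ B g := fun i => by simp
  have hunit : IsUnit a := by
    rw [← residue_ne_zero_iff_isUnit, ha]
    exact inv_ne_zero (leadingCoeff_ne_zero.2 hf)
  refine Submodule.eq_bot_of_le_smul_of_le_jacobson_bot (maximalIdeal R) _ (contentIdeal_FG _) ?_
    (jacobson_eq_maximalIdeal ⊥ bot_ne_top).ge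
  rw [smul_eq_mul]
  refine contentIdeal_le_iff.2 fun n => ?_
  by_cases hn : n < d
  · have := hstep (hBge hgB ⟨n, hn⟩)
    rw [coeff_add, coeff_C_mul, sub_add_eq_sub_sub, sub_self, zero_sub, Ideal.neg_mem_iff] at this
    exact (Ideal.unit_mul_mem_iff_mem _ hunit).1 this
  · rw [coeff_eq_zero_of_degree_lt]
    · exact Ideal.zero_mem _
    · refine (degree_modByMonic_lt f hg.1).trans_le ?_
      rw [degree_eq_natDegree hg.1.ne_zero, hGd hg]
      exact_mod_cast not_lt.1 hn

theorem IsSphericallyComplete.valuationSubring {N : Type*} [Field N] {V : ValuationSubring N}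
    (h : IsSphericallyComplete V N) : IsSphericallyComplete V V :=
  h.of_injective (Algebra.linearMap V N) Subtype.val_injective

end Hensel

/-! ### Relative separable closedness and its passage to the compositum -/

section SeparablyClosed

variable {K₀ N : Type*} [Field K₀] [Field N] [Algebra K₀ N]

/-- Monic divisors of separable polynomials do not grow in a relatively separably closed
extension. -/
theorem IsRelSepClosed.exists_map_eq (h : IsRelSepClosed K₀ N) {f : K₀[X]} (hf : f.Separable)
    {g : N[X]} (hg : g.Monic) (hgf : g ∣ f.map (algebraMap K₀ N)) :
    ∃ g₀ : K₀[X], g₀.map (algebraMap K₀ N) = g := by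
  let Ω := AlgebraicClosure N
  let S := separableClosure K₀ Ω
  -- The roots of `g` are roots of `f`, hence separable over `K₀`; the coefficients of `g` are
  -- therefore separable over `K₀` as well.
  have hlift : g.map (algebraMap N Ω) ∈ lifts (algebraMap S Ω) := by
    rw [(IsAlgClosed.splits (g.map (algebraMap N Ω))).eq_prod_roots_of_monic (hg.map _)]
    refine Subsemiring.multiset_prod_mem _ _ fun p hp => ?_
    obtain ⟨a, ha, rfl⟩ := Multiset.mem_map.1 hp
    have ha0 : f.aeval a = 0 := by
      obtain ⟨q, hq⟩ := hgf
      rw [aeval_def, IsScalarTower.algebraMap_eq K₀ N Ω, ← eval₂_map, hq, eval₂_mul,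
        eval₂_eq_eval_map, (mem_roots'.1 ha).2.eq_zero, zero_mul]
    have haS : a ∈ S := mem_separableClosure_iff.2 (hf.of_dvd (minpoly.dvd K₀ a ha0))
    rw [mem_lifts]
    exact ⟨X - C ⟨a, haS⟩, by simp⟩
  rw [← mem_lifts, lifts_iff_coeff_lifts]
  rw [lifts_iff_coeff_lifts] at hlift
  intro n
  obtain ⟨s, hs⟩ := hlift n
  rw [coeff_map] at hs
  have h1 : algebraMap N Ω (g.coeff n) ∈ separableClosure K₀ Ω := hs ▸ s.2
  have h2 : g.coeff n ∈ separableClosure K₀ N :=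
    (map_mem_separableClosure_iff (IsScalarTower.toAlgHom K₀ N Ω)).1 h1
  rw [show separableClosure K₀ N = ⊥ from h] at h2
  exact IntermediateField.mem_bot.1 h2

theorem IsRelSepClosed.natDegree_minpoly (h : IsRelSepClosed K₀ N) {M : Type*} [Field M]
    [Algebra N M] [Algebra K₀ M] [IsScalarTower K₀ N M] {z : M} (hz : IsSeparable K₀ z) :
    (minpoly N z).natDegree = (minpoly K₀ z).natDegree := by
  have hint : IsIntegral N z := hz.isIntegral.tower_top
  obtain ⟨g, hg⟩ := h.exists_map_eq hz (minpoly.monic hint)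
    (minpoly.dvd_map_of_isScalarTower K₀ N z)
  refine le_antisymm ?_ ?_
  · have := natDegree_le_of_dvd (minpoly.dvd_map_of_isScalarTower K₀ N z)
      ((minpoly.monic hz.isIntegral).map _).ne_zero
    rwa [natDegree_map] at this
  · have h0 : aeval z g = 0 := by
      rw [← aeval_map_algebraMap N, hg, minpoly.aeval]
    have hg0 : g ≠ 0 := by
      rintro rfl
      exact minpoly.ne_zero hint (by rw [← hg, Polynomial.map_zero])
    rw [← hg, natDegree_map]
    exact natDegree_le_of_dvd (minpoly.dvd K₀ z h0) hg0

section Compositum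

variable {K M : Type*} [Field K] [Algebra K₀ K] [Field M] [Algebra K₀ M] [Algebra N M]
  [Algebra K M] [IsScalarTower K₀ N M] [IsScalarTower K₀ K M]

/-- As `K` is algebraic over `K₀`, adjoining it as a ring already gives the field `M`; as its image
is closed under multiplication, its `N`-span is that ring. -/
theorem span_range_algebraMap_eq_top {ι : Type*} [Algebra.IsAlgebraic K₀ K]
    (b : Module.Basis ι K₀ K) (hM : IntermediateField.adjoin N (Set.range (algebraMap K M)) = ⊤) :
    Submodule.span N (Set.range fun i => algebraMap K M (b i)) = ⊤ := by
  have halg : ∀ x ∈ Set.range (algebraMap K M), IsAlgebraic N x := by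
    rintro _ ⟨x, rfl⟩
    exact ((Algebra.IsIntegral.isIntegral (R := K₀) x).map
      (IsScalarTower.toAlgHom K₀ K M)).tower_top.isAlgebraic
  have h1 : Algebra.adjoin N (Set.range (algebraMap K M)) = ⊤ := by
    rw [← IntermediateField.adjoin_toSubalgebra_of_isAlgebraic halg, hM,
      IntermediateField.top_toSubalgebra]
  have h2 : Submodule.span N (Set.range (algebraMap K M)) = ⊤ := by
    have := Algebra.adjoin_eq_span N (Set.range (algebraMap K M))
    rw [h1, show Submonoid.closure (Set.range (algebraMap K M)) =
      MonoidHom.mrange (algebraMap K M : K →* M) by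
        rw [← Submonoid.closure_eq (MonoidHom.mrange (algebraMap K M : K →* M))]; rfl] at this
    exact this.symm
  rw [eq_top_iff, ← h2, Submodule.span_le]
  rintro _ ⟨x, rfl⟩
  have hx : x ∈ Submodule.span K₀ (Set.range b) := b.span_eq ▸ Submodule.mem_top
  refine Submodule.span_induction ?_ ?_ ?_ ?_ hx
  · rintro _ ⟨i, rfl⟩
    exact Submodule.subset_span ⟨i, rfl⟩
  · simp
  · intro x y _ _ hx hy
    rw [map_add]
    exact Submodule.add_mem _ hx hy
  · intro a x _ hx
    rw [Algebra.smul_def, map_mul, ← IsScalarTower.algebraMap_apply,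
      IsScalarTower.algebraMap_apply K₀ N M, ← Algebra.smul_def]
    exact Submodule.smul_mem _ _ hx

theorem finiteDimensional_compositum [FiniteDimensional K₀ K]
    (hM : IntermediateField.adjoin N (Set.range (algebraMap K M)) = ⊤) :
    FiniteDimensional N M := by
  rw [FiniteDimensional, Module.finite_def,
    ← span_range_algebraMap_eq_top (Module.finBasis K₀ K) hM]
  exact Submodule.fg_span (Set.finite_range _)

/-- An `N`-embedding of `M` is determined by its restriction to `K`. -/
theorem finSepDegree_compositum_le [FiniteDimensional K₀ K]
    (hM : IntermediateField.adjoin N (Set.range (algebraMap K M)) = ⊤) :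
    Field.finSepDegree N M ≤ Field.finSepDegree K₀ K := by
  have := finiteDimensional_compositum (K₀ := K₀) hM
  let Ω := AlgebraicClosure M
  rw [Field.finSepDegree_eq_of_isAlgClosed N M Ω, Field.finSepDegree_eq_of_isAlgClosed K₀ K Ω]
  refine Nat.card_le_card_of_injective
    (fun σ : M →ₐ[N] Ω => (σ.restrictScalars K₀).comp (IsScalarTower.toAlgHom K₀ K M))
    fun σ τ hστ => ?_
  have hspan := span_range_algebraMap_eq_top (Module.finBasis K₀ K) hM
  refine AlgHom.toLinearMap_injective (LinearMap.ext_on hspan ?_)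
  rintro _ ⟨i, rfl⟩
  exact DFunLike.congr_fun hστ _

/-- For `x` separable over `K`, put `E = K(x)` and let `T` be the separable closure of `K₀` in `E`.
Then `[T : K₀] = [K : K₀]_s [E : K]`. A primitive element of `T` keeps its degree over `N`, so `[T :
K₀] ≤ [M : N]_s ≤ [K : K₀]_s`, which forces `E = K`. -/
theorem IsRelSepClosed.compositum [FiniteDimensional K₀ K] (h : IsRelSepClosed K₀ N)
    (hM : IntermediateField.adjoin N (Set.range (algebraMap K M)) = ⊤) :
    IsRelSepClosed K M := by
  have := finiteDimensional_compositum (K₀ := K₀) hM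
  rw [IsRelSepClosed, eq_bot_iff]
  intro x hx
  rw [mem_separableClosure_iff] at hx
  let E := IntermediateField.adjoin K {x}
  have : FiniteDimensional K E := IntermediateField.adjoin.finiteDimensional hx.isIntegral
  have : Algebra.IsSeparable K E :=
    (IntermediateField.isSeparable_adjoin_simple_iff_isSeparable ..).2 hx
  have : FiniteDimensional K₀ E := .trans K₀ K E
  have : IsScalarTower K₀ E M := .of_algebraMap_eq fun _ => rfl
  let T := separableClosure K₀ E
  obtain ⟨z, hz⟩ := Field.exists_primitive_element K₀ T
  rw [Field.primitive_element_iff_minpoly_natDegree_eq] at hz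
  let φ : T →ₐ[K₀] M := (IsScalarTower.toAlgHom K₀ E M).comp T.val
  have hsep : IsSeparable K₀ (φ z) := by
    rw [IsSeparable, minpoly.algHom_eq φ φ.injective]
    exact Algebra.IsSeparable.isSeparable K₀ z
  have h1 : Module.finrank K₀ T ≤ Field.finSepDegree N M := by
    rw [← hz, ← minpoly.algHom_eq φ φ.injective, ← h.natDegree_minpoly hsep,
      ← IntermediateField.adjoin.finrank (hsep.tower_top N).isIntegral]
    have : Algebra.IsSeparable N (IntermediateField.adjoin N {φ z}) :=
      (IntermediateField.isSeparable_adjoin_simple_iff_isSeparable ..).2 (hsep.tower_top N)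
    rw [← Field.finSepDegree_eq_finrank_of_isSeparable,
      ← Field.finSepDegree_mul_finSepDegree_of_isAlgebraic N (IntermediateField.adjoin N {φ z}) M]
    exact Nat.le_mul_of_pos_right _ (NeZero.pos _)
  have h2 : Field.finSepDegree K₀ K * Module.finrank K E = Module.finrank K₀ T := by
    rw [← Field.finSepDegree_eq_finrank_of_isSeparable K E,
      Field.finSepDegree_mul_finSepDegree_of_isAlgebraic,
      ← Field.finSepDegree_mul_finSepDegree_of_isAlgebraic K₀ T E,
      Field.finSepDegree_eq_finrank_of_isSeparable, IsPurelyInseparable.finSepDegree_eq_one,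
      mul_one]
  have h3 : Module.finrank K E = 1 := by
    have h4 := h2.trans_le (h1.trans (finSepDegree_compositum_le (K₀ := K₀) hM))
    have h5 : 0 < Field.finSepDegree K₀ K := NeZero.pos _
    have h6 : 0 < Module.finrank K E := Module.finrank_pos
    nlinarith
  exact IntermediateField.finrank_eq_one_iff.1 h3 ▸ IntermediateField.mem_adjoin_simple_self K x

end Compositum

end SeparablyClosed

/-! ### Henselianity of `K₀`: uniqueness of extensions to algebraic extensions -/

section Uniqueness

open IsLocalRing

universe u v

variable {K₀ : Type u} [Field K₀] {K : Type v} [Field K] [Algebra K₀ K]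
  {w : ValuationSubring K₀} {W : ValuationSubring K}

theorem Extends.algebraMap_comp_subtype (h : Extends w W) :
    (algebraMap K₀ K).comp w.subtype = W.subtype.comp h.ringMap := rfl

theorem Extends.residue_comp_ringMap (h : Extends w W) :
    (residue W).comp h.ringMap = h.residueMap.comp (residue w) := rfl

theorem Extends.mem_of_isIntegralElem (h : Extends w W) {x : K}
    (hx : ((algebraMap K₀ K).comp w.subtype).IsIntegralElem x) : x ∈ W := by
  obtain ⟨p, hp, hp0⟩ := hx
  have : IsIntegral W x := ⟨p.map h.ringMap, hp.map _, by
    rw [eval₂_map]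
    exact hp0⟩
  obtain ⟨y, rfl⟩ := IsIntegrallyClosed.isIntegral_iff.1 this
  exact y.2

/-- Every nonzero polynomial is a scalar multiple of a polynomial over the valuation ring with
nonzero reduction. -/
theorem exists_map_subtype_eq_C_mul {m : K₀[X]} (hm : m ≠ 0) :
    ∃ c : K₀, c ≠ 0 ∧ ∃ f : w[X], f.map w.subtype = C c * m ∧ f.map (residue w) ≠ 0 := by
  obtain ⟨i, hi, hmax⟩ := m.support.exists_max_image (fun i => w.valuation (m.coeff i))
    (support_nonempty.2 hm)
  have hi0 : m.coeff i ≠ 0 := mem_support_iff.1 hi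
  have hlift : C (m.coeff i)⁻¹ * m ∈ lifts w.subtype := by
    rw [lifts_iff_coeff_lifts]
    intro n
    rw [coeff_C_mul]
    refine ⟨⟨(m.coeff i)⁻¹ * m.coeff n, ?_⟩, rfl⟩
    rw [← w.valuation_le_one_iff, map_mul, map_inv₀]
    by_cases hn : n ∈ m.support
    · exact inv_mul_le_one_of_le₀ (hmax n hn) zero_le
    · simp [notMem_support_iff.1 hn]
  obtain ⟨f, hf⟩ := (mem_lifts _).1 hlift
  refine ⟨_, inv_ne_zero hi0, f, hf, fun h0 => ?_⟩
  have h1 : f.coeff i = 1 := Subtype.val_injective <| by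
    have := congrArg (coeff · i) hf
    simpa [hi0] using this
  have h2 := congrArg (coeff · i) h0
  simp [h1] at h2

variable {N : Type*} [Field N] [Algebra K₀ N] {VN : ValuationSubring N}

/-- Scale the minimal polynomial to a primitive `f`. If its leading coefficient is not a unit, the
reduction of `f` has smaller degree, and Hensel's factorization over `N` gives a monic factor of
that degree. The factor descends to `K₀`, against irreducibility. -/
theorem Extends.isIntegralElem_of_isSeparable (hN : Extends w VN)
    (hVN : IsSphericallyComplete VN N) (hs : IsRelSepClosed K₀ N) (hW : Extends w W) {x : K}
    (hx : IsSeparable K₀ x) (hxW : x ∈ W) :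
    ((algebraMap K₀ K).comp w.subtype).IsIntegralElem x := by
  set m := minpoly K₀ x with hm
  have hmm : m.Monic := minpoly.monic hx.isIntegral
  have hirr : Irreducible m := minpoly.irreducible hx.isIntegral
  obtain ⟨c, hc, f, hf, hf0⟩ := exists_map_subtype_eq_C_mul (w := w) hmm.ne_zero
  have hfd : f.natDegree = m.natDegree := by
    rw [← natDegree_map_eq_of_injective w.subtype_injective, hf, natDegree_C_mul hc]
  have hfx : eval₂ ((algebraMap K₀ K).comp w.subtype) x f = 0 := by
    rw [← eval₂_map, hf, eval₂_mul, ← aeval_def x m, minpoly.aeval, mul_zero]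
  by_cases hlc : c⁻¹ ∈ w
  · refine ⟨C ⟨c⁻¹, hlc⟩ * f, ?_, by rw [eval₂_mul, hfx, mul_zero]⟩
    refine w.subtype_injective.monic_map_iff.2 ?_
    rw [Polynomial.map_mul, hf, map_C, ValuationSubring.subtype_apply, ← mul_assoc, ← C_mul,
      inv_mul_cancel₀ hc, C_1, one_mul]
    exact hmm
  have hlt : (f.map (residue w)).natDegree < m.natDegree := by
    rw [← hfd]
    refine (natDegree_map_le).lt_of_ne fun heq => hlc ?_
    have h1 : residue w (f.coeff f.natDegree) ≠ 0 := by
      rw [← coeff_map, ← heq]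
      exact leadingCoeff_ne_zero.2 hf0
    rw [residue_ne_zero_iff_isUnit] at h1
    obtain ⟨y, hy⟩ := h1.exists_right_inv
    have h2 : (f.coeff f.natDegree : K₀) = c := by
      have := congrArg (coeff · f.natDegree) hf
      simp only [coeff_map, coeff_C_mul, hfd] at this
      rw [hmm.coeff_natDegree, mul_one] at this
      rw [hfd]
      exact this
    have h3 : (c * y : K₀) = 1 := by
      rw [← h2]
      exact congrArg Subtype.val hy
    rw [inv_eq_of_mul_eq_one_right h3]
    exact y.2
  -- The reduction of `f` is nonzero but vanishes at the residue of `x`, so it is not constant.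
  have hpos : 0 < (f.map (residue w)).natDegree := by
    by_contra! h0
    obtain ⟨e, he⟩ := natDegree_eq_zero.1 (Nat.le_zero.1 h0)
    have h1 : eval₂ hW.ringMap ⟨x, hxW⟩ f = 0 := W.subtype_injective <| by
      rw [hom_eval₂, map_zero, ← hfx]
      rfl
    have h2 := congrArg (residue W) h1
    rw [hom_eval₂, map_zero, hW.residue_comp_ringMap, ← eval₂_map, ← he, eval₂_C,
      map_eq_zero] at h2
    rw [← he, h2, C_0] at hf0
    exact hf0 rfl
  have hred : (f.map hN.ringMap).map (residue VN) =
      (f.map (residue w)).map hN.residueMap := by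
    rw [Polynomial.map_map, Polynomial.map_map, hN.residue_comp_ringMap]
  obtain ⟨g, hgm, hgd, hgf⟩ := exists_monic_dvd_of_isSphericallyComplete hVN.valuationSubring
    (f.map hN.ringMap) (by
      rw [hred]
      exact (Polynomial.map_ne_zero_iff hN.residueMap.injective).2 hf0)
  rw [hred, natDegree_map] at hgd
  have hdvd : g.map VN.subtype ∣ m.map (algebraMap K₀ N) := by
    have h1 : g.map VN.subtype ∣ (f.map hN.ringMap).map VN.subtype := by
      obtain ⟨q, hq⟩ := hgf
      exact ⟨q.map VN.subtype, by rw [hq, Polynomial.map_mul]⟩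
    rw [Polynomial.map_map, ← hN.algebraMap_comp_subtype, ← Polynomial.map_map, hf,
      Polynomial.map_mul, map_C, mul_comm] at h1
    exact (isUnit_C.2 (by simpa using hc)).dvd_mul_right.1 h1
  obtain ⟨g₀, hg₀⟩ := hs.exists_map_eq hx (hgm.map VN.subtype) hdvd
  rw [← hg₀, map_dvd_map'] at hdvd
  have hg₀d : g₀.natDegree = (f.map (residue w)).natDegree := by
    rw [← hgd, ← natDegree_map (algebraMap K₀ N), hg₀, hgm.natDegree_map]
  rcases hirr.dvd_iff.1 hdvd with h | h
  · exact absurd (natDegree_eq_zero_of_isUnit h) (by omega)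
  · exact absurd (natDegree_eq_of_degree_eq (degree_eq_degree_of_associated h)) (by omega)

variable [Algebra.IsAlgebraic K₀ K]

/-- The integral closure of the valuation ring does not mention `W`, whence uniqueness. Inseparable
elements are reduced to the separable case by a power of the characteristic exponent. -/
theorem Extends.mem_iff_isIntegralElem (hN : Extends w VN)
    (hVN : IsSphericallyComplete VN N) (hs : IsRelSepClosed K₀ N) (hW : Extends w W) {x : K} :
    x ∈ W ↔ ((algebraMap K₀ K).comp w.subtype).IsIntegralElem x := by
  refine ⟨fun hx => ?_, hW.mem_of_isIntegralElem⟩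
  obtain ⟨q, _⟩ := ExpChar.exists K₀
  have : ExpChar (separableClosure K₀ K) q := expChar_of_injective_algebraMap
    (algebraMap K₀ (separableClosure K₀ K)).injective q
  obtain ⟨n, y, hy⟩ := IsPurelyInseparable.pow_mem (separableClosure K₀ K) q x
  have hsep : IsSeparable K₀ (x ^ q ^ n) := by
    rw [← mem_separableClosure_iff, ← hy]
    exact y.2
  obtain ⟨p, hp, hp0⟩ := hN.isIntegralElem_of_isSeparable hVN hs hW hsep (pow_mem hx _)
  refine ⟨expand w (q ^ n) p, hp.expand (pow_pos (expChar_pos K₀ q) n), ?_⟩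
  rw [expand_eq_comp_X_pow, eval₂_comp, eval₂_X_pow, hp0]

/-- A relatively separably closed subfield of a maximal field is henselian. -/
theorem Extends.eq_of_extends (hN : Extends w VN) (hVN : IsSphericallyComplete VN N)
    (hs : IsRelSepClosed K₀ N) (hW : Extends w W) {W' : ValuationSubring K}
    (hW' : Extends w W') : W' = W := by
  ext x
  rw [hN.mem_iff_isIntegralElem hVN hs hW, hN.mem_iff_isIntegralElem hVN hs hW']

end Uniqueness

/-! ### Valuation bases of defectless extensions -/

section ValuationBasis

open IsLocalRing

universe u v

variable {K₀ : Type u} [Field K₀] {K : Type v} [Field K] [Algebra K₀ K]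
  {V₀ : ValuationSubring K₀} {V : ValuationSubring K}

/-- A basis is a valuation basis if the value of each linear combination is the maximum of the
values of its terms. -/
def IsValuationBasis {ι : Type*} [Fintype ι] (V : ValuationSubring K)
    (b : Module.Basis ι K₀ K) : Prop :=
  ∀ (c : ι → K₀) (i : ι), V.valuation (c i • b i) ≤ V.valuation (∑ j, c j • b j)

/-- Coarsening is a monotone map of value groups. This is how defectlessness for `v` serves all
coarsenings at once. -/
theorem IsValuationBasis.of_le {ι : Type*} [Fintype ι] {b : Module.Basis ι K₀ K}
    (h : IsValuationBasis V b) {W : ValuationSubring K} (hVW : V ≤ W) : IsValuationBasis W b := by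
  intro c i
  rw [← V.mapOfLE_valuation_apply W hVW, ← V.mapOfLE_valuation_apply W hVW]
  exact V.monotone_mapOfLE W hVW (h c i)

/-- Lifts of a family that is linearly independent over the residue field. -/
theorem Extends.exists_valuation_sum_smul_eq (h : Extends V₀ V) {ι : Type*} [Fintype ι]
    [Nonempty ι] (u : ι → V)
    (hu : letI := h.residueMap.toAlgebra
      LinearIndependent (ResidueField V₀) fun i => residue V (u i)) (c : ι → K₀) :
    ∃ a : K₀, V.valuation (∑ i, c i • (u i : K)) = V.valuation (algebraMap K₀ K a) ∧
      ∀ i, V.valuation (algebraMap K₀ K (c i)) ≤ V.valuation (∑ i, c i • (u i : K)) := by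
  obtain ⟨i, -, hmax⟩ := Finset.univ.exists_max_image
    (fun i => V.valuation (algebraMap K₀ K (c i))) Finset.univ_nonempty
  suffices h1 : V.valuation (∑ i, c i • (u i : K)) = V.valuation (algebraMap K₀ K (c i)) from
    ⟨c i, h1, fun j => h1 ▸ hmax j (Finset.mem_univ j)⟩
  by_cases hi : c i = 0
  · have h0 (j : ι) : c j = 0 := by
      have := hmax j (Finset.mem_univ j)
      rw [hi, map_zero, map_zero, le_zero_iff] at this
      simpa using this
    simp [h0]
  -- After division by a coefficient of largest value the `i`-th coefficient is `1`, so linear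
  -- independence makes the reduction of the sum nonzero.
  have hmem (j : ι) : c j / c i ∈ V₀ := by
    rw [← h.mem_iff, ← V.valuation_le_one_iff, map_div₀, map_div₀]
    exact div_le_one_of_le₀ (hmax j (Finset.mem_univ j)) zero_le
  set d : ι → V₀ := fun j => ⟨c j / c i, hmem j⟩ with hd
  set y : V := ∑ j, h.ringMap (d j) * u j with hy
  have hy0 : residue V y ≠ 0 := by
    intro h0
    let := h.residueMap.toAlgebra
    have h1 := Fintype.linearIndependent_iff.1 hu (fun j => residue V₀ (d j)) (by
      rw [← h0, hy, map_sum]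
      simp only [Algebra.smul_def, map_mul]
      rfl) i
    have hdi : d i = 1 := Subtype.ext (div_self hi)
    rw [hdi, map_one] at h1
    exact one_ne_zero h1
  rw [residue_ne_zero_iff_isUnit, V.valuation_eq_one_iff] at hy0
  have hsum : ∑ j, c j • (u j : K) = algebraMap K₀ K (c i) * (y : K) := by
    have : (y : K) = ∑ j, algebraMap K₀ K (c j / c i) * (u j : K) := by
      rw [hy, ← V.subtype_apply, map_sum]
      rfl
    rw [this, Finset.mul_sum]
    refine Finset.sum_congr rfl fun j _ => ?_
    rw [← mul_assoc, ← map_mul, mul_div_cancel₀ _ hi, Algebra.smul_def]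
  rw [hsum, map_mul, hy0, mul_one]

/-- Products of lifts of a residue basis with representatives of the value cosets work: inside one
coset residues prevent cancellation, and sums from different cosets have different values. Their
number is `e f`, so they form a basis. -/
theorem Extends.exists_isValuationBasis (h : Extends V₀ V) [FiniteDimensional K₀ K]
    (hef : Module.finrank K₀ K = ramificationIndex K₀ V * h.inertiaDegree) :
    ∃ (ι : Type v) (_ : Fintype ι) (b : Module.Basis ι K₀ K), IsValuationBasis V b := by
  classical
  -- Index and rank are `0` by default when infinite; positivity of the product excludes this.
  have hpos : 0 < ramificationIndex K₀ V * h.inertiaDegree := hef ▸ Module.finrank_pos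
  let := h.residueMap.toAlgebra
  have hf : 0 < Module.finrank (ResidueField V₀) (ResidueField V) := Nat.pos_of_mul_pos_left hpos
  have : Module.Finite (ResidueField V₀) (ResidueField V) := Module.finite_of_finrank_pos hf
  let G := valueSubgroup K₀ V
  have hG : G.index ≠ 0 := (Nat.pos_of_mul_pos_right hpos).ne'
  have : G.FiniteIndex := ⟨hG⟩
  let Q := V.ValueGroupˣ ⧸ G
  let : Fintype Q := Fintype.ofFinite Q
  let J := ULift.{v} (Fin (Module.finrank (ResidueField V₀) (ResidueField V)))
  have : Nonempty J := ⟨⟨⟨0, hf⟩⟩⟩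
  let κ : Module.Basis J (ResidueField V₀) (ResidueField V) :=
    (Module.finBasis _ _).reindex Equiv.ulift.symm
  choose u hu using fun j => residue_surjective (κ j)
  choose t ht using fun q : Q => V.valuation_surjective (q.out : V.ValueGroup)
  have hu' : LinearIndependent (ResidueField V₀) fun j => residue V (u j) := by
    simp only [hu]
    exact κ.linearIndependent
  have ht0 (q : Q) : t q ≠ 0 := by
    intro h0
    have := ht q
    rw [h0, map_zero] at this
    exact q.out.ne_zero this.symm
  let b : Q × J → K := fun p => (u p.2 : K) * t p.1
  have hb0 (p : Q × J) : b p ≠ 0 := by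
    refine mul_ne_zero (fun h0 => κ.ne_zero p.2 ?_) (ht0 p.1)
    rw [← hu, show u p.2 = 0 from Subtype.ext h0, map_zero]
  have key (c : Q × J → K₀) (p : Q × J) :
      V.valuation (c p • b p) ≤ V.valuation (∑ p, c p • b p) := by
    let s : Q → K := fun q => ∑ j, c (q, j) • (u j : K)
    have hs (q : Q) := h.exists_valuation_sum_smul_eq u hu' fun j => c (q, j)
    have hsum : ∑ p, c p • b p = ∑ q, s q * t q := by
      rw [Fintype.sum_prod_type]
      refine Finset.sum_congr rfl fun q _ => ?_
      rw [Finset.sum_mul]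
      exact Finset.sum_congr rfl fun j _ => (smul_mul_assoc _ _ _).symm
    have hdist {q q' : Q} (h0 : V.valuation (s q * t q) ≠ 0)
        (heq : V.valuation (s q * t q) = V.valuation (s q' * t q')) : q = q' := by
      obtain ⟨a, ha, -⟩ := hs q
      obtain ⟨a', ha', -⟩ := hs q'
      have hva : V.valuation (s q * t q) = V.valuation (algebraMap K₀ K a) * q.out := by
        rw [map_mul, ht, ← ha]
      have hva' : V.valuation (s q' * t q') = V.valuation (algebraMap K₀ K a') * q'.out := by
        rw [map_mul, ht, ← ha']
      have ha0 : a ≠ 0 := by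
        rintro rfl
        exact h0 (by simpa using hva)
      have ha0' : a' ≠ 0 := by
        rintro rfl
        exact h0 (heq.trans (by simpa using hva'))
      rw [← q.out_eq', ← q'.out_eq']
      refine QuotientGroup.eq.2 ⟨Units.mk0 a ha0 * (Units.mk0 a' ha0')⁻¹, ?_⟩
      rw [map_mul, map_inv, mul_inv_eq_iff_eq_mul, mul_assoc, eq_inv_mul_iff_mul_eq,
        mul_comm q.out, mul_comm q'.out]
      ext
      exact (hva.symm.trans heq).trans hva'
    obtain ⟨q₀, -, hmax⟩ := Finset.univ.exists_max_image
      (fun q => V.valuation (s q * t q)) ⟨p.1, Finset.mem_univ _⟩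
    have hval : V.valuation (∑ q, s q * t q) = V.valuation (s q₀ * t q₀) ∨
        V.valuation (s q₀ * t q₀) = 0 := by
      by_cases h0 : V.valuation (s q₀ * t q₀) = 0
      · exact Or.inr h0
      refine Or.inl (V.valuation.map_sum_eq_of_lt (f := fun q => s q * t q) (Finset.mem_univ q₀)
        fun q hq => ?_)
      refine (hmax q (Finset.mem_univ q)).lt_of_ne fun heq => ?_
      rw [Finset.mem_sdiff, Finset.mem_singleton] at hq
      exact hq.2 (hdist h0 heq.symm).symm
    have hle : V.valuation (c p • b p) ≤ V.valuation (s q₀ * t q₀) := by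
      refine le_trans ?_ (hmax p.1 (Finset.mem_univ _))
      obtain ⟨a, -, ha⟩ := hs p.1
      change V.valuation (c p • ((u p.2 : K) * t p.1)) ≤ V.valuation (s p.1 * t p.1)
      rw [Algebra.smul_def, ← mul_assoc, map_mul, map_mul, map_mul]
      refine mul_le_mul_left ?_ _
      exact (mul_le_of_le_one_right' (V.valuation_le_one _)).trans (ha p.2)
    rw [hsum]
    rcases hval with h1 | h1
    · exact hle.trans h1.ge
    · exact hle.trans (h1.trans_le zero_le)
  have hli : LinearIndependent K₀ b := by
    rw [Fintype.linearIndependent_iff]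
    intro c hc p
    have := key c p
    rw [hc, map_zero, le_zero_iff, V.valuation.zero_iff, smul_eq_zero] at this
    exact this.resolve_right (hb0 p)
  have hcard : Fintype.card (Q × J) = Module.finrank K₀ K := by
    rw [hef, Fintype.card_prod, ← Nat.card_eq_fintype_card, Fintype.card_ulift, Fintype.card_fin]
    rfl
  have : Nonempty (Q × J) := ⟨(Quotient.mk'' 1, Classical.arbitrary J)⟩
  refine ⟨Q × J, inferInstance, basisOfLinearIndependentOfCardEqFinrank hli hcard, ?_⟩
  intro c p
  simpa using key c p

end ValuationBasis

/-! ### Existence of extensions and of compatible coarsenings -/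

section Coarsening

universe u v

variable {K : Type u} [Field K] {L : Type v} [Field L] [Algebra K L]

theorem exists_extends (V : ValuationSubring K) (L : Type v) [Field L] [Algebra K L] :
    ∃ V' : ValuationSubring L, Extends V V' := by
  obtain ⟨V', hV', hloc⟩ :=
    IsLocalRing.exists_factor_valuationRing ((algebraMap K L).comp V.subtype)
  refine ⟨V', ValuationSubring.ext _ _ fun x => ?_⟩
  rw [ValuationSubring.mem_comap]
  refine ⟨fun hx => ?_, fun hx => hV' ⟨x, hx⟩⟩
  by_contra hxV
  have hx0 : x ≠ 0 := by
    rintro rfl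
    exact hxV V.zero_mem
  have hinv : x⁻¹ ∈ V := (V.mem_or_inv_mem x).resolve_left hxV
  have hu : IsUnit (⟨x⁻¹, hinv⟩ : V) := hloc.map_nonunit _ <|
    IsUnit.of_mul_eq_one ⟨algebraMap K L x, hx⟩ <| Subtype.ext <| by
      change algebraMap K L x⁻¹ * algebraMap K L x = 1
      rw [← map_mul, inv_mul_cancel₀ hx0, map_one]
  obtain ⟨y, hy⟩ := hu.exists_right_inv
  have hy' : x⁻¹ * (y : K) = 1 := congrArg Subtype.val hy
  refine hxV ?_
  rw [← inv_inv x, inv_eq_of_mul_eq_one_right hy']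
  exact y.2

theorem Extends.exists_coarsening {V w : ValuationSubring K} {V' : ValuationSubring L}
    (h : Extends V V') (hw : V ≤ w) : ∃ W : ValuationSubring L, V' ≤ W ∧ Extends w W := by
  -- The localization of `V'` at the elements of `V` that are units of `w`; an overring of a
  -- valuation ring is again a valuation ring.
  let S : Subring L :=
    { carrier := {x | ∃ s ∈ V, s ≠ 0 ∧ s⁻¹ ∈ w ∧ algebraMap K L s * x ∈ V'}
      zero_mem' := ⟨1, V.one_mem, one_ne_zero, by simp, by simp⟩
      one_mem' := ⟨1, V.one_mem, one_ne_zero, by simp, by simp⟩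
      add_mem' := by
        rintro x y ⟨s, hs, hs0, hsw, hsx⟩ ⟨t, ht, ht0, htw, hty⟩
        refine ⟨s * t, mul_mem hs ht, mul_ne_zero hs0 ht0, ?_, ?_⟩
        · rw [mul_inv]
          exact mul_mem hsw htw
        · rw [show algebraMap K L (s * t) * (x + y) =
            algebraMap K L t * (algebraMap K L s * x) + algebraMap K L s * (algebraMap K L t * y) by
              rw [map_mul]; ring]
          exact add_mem (mul_mem ((h.mem_iff t).2 ht) hsx) (mul_mem ((h.mem_iff s).2 hs) hty)
      mul_mem' := by
        rintro x y ⟨s, hs, hs0, hsw, hsx⟩ ⟨t, ht, ht0, htw, hty⟩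
        refine ⟨s * t, mul_mem hs ht, mul_ne_zero hs0 ht0, ?_, ?_⟩
        · rw [mul_inv]
          exact mul_mem hsw htw
        · rw [show algebraMap K L (s * t) * (x * y) =
            (algebraMap K L s * x) * (algebraMap K L t * y) by rw [map_mul]; ring]
          exact mul_mem hsx hty
      neg_mem' := by
        rintro x ⟨s, hs, hs0, hsw, hsx⟩
        exact ⟨s, hs, hs0, hsw, by rw [mul_neg]; exact neg_mem hsx⟩ }
  have hS (x : L) : x ∈ S ↔ ∃ s ∈ V, s ≠ 0 ∧ s⁻¹ ∈ w ∧ algebraMap K L s * x ∈ V' := Iff.rfl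
  have hle : V'.toSubring ≤ S := fun x hx =>
    ⟨1, V.one_mem, one_ne_zero, by simp, by simpa using hx⟩
  refine ⟨V'.ofLE S hle, hle, ValuationSubring.ext _ _ fun x => ?_⟩
  rw [ValuationSubring.mem_comap]
  change algebraMap K L x ∈ S ↔ _
  rw [hS]
  constructor
  · rintro ⟨s, -, hs0, hsw, hsx⟩
    rw [← map_mul, h.mem_iff] at hsx
    rw [← inv_mul_cancel_left₀ hs0 x]
    exact mul_mem hsw (hw hsx)
  · intro hx
    rcases V.mem_or_inv_mem x with hxV | hxV
    · exact ⟨1, V.one_mem, one_ne_zero, by simp,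
        by simpa using (h.mem_iff x).2 hxV⟩
    · by_cases hx0 : x = 0
      · exact ⟨1, V.one_mem, one_ne_zero, by simp, by simp [hx0]⟩
      · exact ⟨x⁻¹, hxV, inv_ne_zero hx0, by simpa using hx, by
          rw [← map_mul, inv_mul_cancel₀ hx0, map_one]
          exact V'.one_mem⟩

end Coarsening

/-! ### Approximation of elements of the compositum by elements of `K` -/

section Compositum

variable {K₀ N K M : Type*} [Field K₀] [Field N] [Algebra K₀ N] [Field K] [Algebra K₀ K] [Field M]
  [Algebra K₀ M] [Algebra N M] [Algebra K M] [IsScalarTower K₀ N M] [IsScalarTower K₀ K M]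
  {w : ValuationSubring K₀} {VN : ValuationSubring N} {W : ValuationSubring K}
  {U : ValuationSubring M}

theorem IsImmediate.exists_approximation (h : IsImmediate w VN) :
    ∃ a : N → K₀, a 0 = 0 ∧
      ∀ z ≠ 0, VN.valuation (z - algebraMap K₀ N (a z)) < VN.valuation z := by
  classical
  choose a ha using fun (z : N) (hz : z ≠ 0) => h.exists_sub_lt hz
  exact ⟨fun z => if hz : z = 0 then 0 else a z hz, by simp,
    fun z hz => by simpa [hz] using ha z hz⟩

/-- Elements of the compositum are approximated by the elements of `K` obtained by approximating
their coefficients with respect to a valuation basis. -/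
theorem IsValuationBasis.valuation_sum_sub_lt {ι : Type*} [Fintype ι] {b : Module.Basis ι K₀ K}
    (hb : IsValuationBasis W b) (hU : Extends VN U) (hWU : Extends W U) {a : N → K₀}
    (ha0 : a 0 = 0)
    (ha : ∀ z ≠ 0, VN.valuation (z - algebraMap K₀ N (a z)) < VN.valuation z)
    (c : ι → N) (hc : ∑ i, c i • algebraMap K M (b i) ≠ 0) :
    U.valuation (∑ i, c i • algebraMap K M (b i) - algebraMap K M (∑ i, a (c i) • b i)) <
      U.valuation (∑ i, c i • algebraMap K M (b i)) := by
  set x' : K := ∑ i, a (c i) • b i with hx'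
  have hterm (i : ι) :
      algebraMap K M (a (c i) • b i) = algebraMap N M (algebraMap K₀ N (a (c i))) *
        algebraMap K M (b i) := by
    rw [Algebra.smul_def, map_mul, ← IsScalarTower.algebraMap_apply,
      ← IsScalarTower.algebraMap_apply]
  have haval (z : N) : VN.valuation (algebraMap K₀ N (a z)) = VN.valuation z := by
    obtain rfl | hz := eq_or_ne z 0
    · simp [ha0]
    · simpa using VN.valuation.map_sub_eq_of_lt_right (ha z hz)
  -- The valuation basis property is applied in `K`, to the approximated coefficients; that `b`
  -- behaves the same way over `N` is not presupposed.
  have hle (i : ι) :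
      U.valuation (c i • algebraMap K M (b i)) ≤ U.valuation (algebraMap K M x') := by
    have h1 := (hWU.valuation_le_iff _ _).2 (hb (fun i => a (c i)) i)
    rwa [hterm, map_mul, (hU.valuation_eq_iff _ _).2 (haval (c i)), ← map_mul,
      ← Algebra.smul_def] at h1
  have hx'0 : 0 < U.valuation (algebraMap K M x') := by
    by_contra! h0
    refine hc (Finset.sum_eq_zero fun i _ => ?_)
    rw [← U.valuation.zero_iff]
    exact le_zero_iff.1 ((hle i).trans h0)
  have hdiff : ∑ i, c i • algebraMap K M (b i) - algebraMap K M x' =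
      ∑ i, (c i - algebraMap K₀ N (a (c i))) • algebraMap K M (b i) := by
    rw [hx', map_sum, ← Finset.sum_sub_distrib]
    refine Finset.sum_congr rfl fun i _ => ?_
    rw [hterm, sub_smul, Algebra.smul_def (algebraMap K₀ N _)]
  have hlt : U.valuation (∑ i, c i • algebraMap K M (b i) - algebraMap K M x') <
      U.valuation (algebraMap K M x') := by
    rw [hdiff]
    refine U.valuation.map_sum_lt hx'0.ne' fun i _ => ?_
    by_cases hi : c i = 0
    · simpa [hi, ha0] using hx'0
    · refine lt_of_lt_of_le ?_ (hle i)
      rw [Algebra.smul_def, Algebra.smul_def, map_mul, map_mul]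
      refine mul_lt_mul_of_pos_right ((hU.valuation_lt_iff _ _).2 (ha _ hi)) ?_
      rw [zero_lt_iff, U.valuation.ne_zero_iff]
      simpa using b.ne_zero i
  have := U.valuation.map_add_eq_of_lt_left hlt
  rw [add_sub_cancel] at this
  rwa [this]

end Compositum

end ValuedFieldExt

/-! ### The main theorem -/

open ValuedFieldExt in
/-- `N w` is the given maximal immediate extension for the coarsening `w` of `v` (valuations are
given by their rings, so coarsenings of `V₀` are the valuation rings containing `V₀`), with
valuation ring `VN w`.  `M` runs over the composita of `N w` and `K` over `K₀`. -/
theorem lemma3p1 {K₀ : Type*} [Field K₀] (V₀ : ValuationSubring K₀)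
    (N : Set.Ici V₀ → Type*) [∀ w, Field (N w)] [∀ w, Algebra K₀ (N w)]
    (VN : ∀ w, ValuationSubring (N w))
    (hN : ∀ w, ValuedFieldExt.IsMaximalImmediate w.1 (VN w))
    (hNsep : ∀ w, ValuedFieldExt.IsRelSepClosed K₀ (N w))
    {K : Type*} [Field K] [Algebra K₀ K] (V : ValuationSubring K)
    (hV : ValuedFieldExt.Extends V₀ V)
    (hdl : ValuedFieldExt.IsDefectless K V₀) :
    ∀ w : Set.Ici V₀,
      -- `w` extends uniquely to a coarsening `W` of the valuation of `K`
      ∃ W : ValuationSubring K,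
        (V ≤ W ∧ ValuedFieldExt.Extends w.1 W) ∧
        (∀ W' : ValuationSubring K, V ≤ W' → ValuedFieldExt.Extends w.1 W' → W' = W) ∧
        ∀ (M : Type*) [Field M] [Algebra K₀ M] [Algebra (N w) M] [Algebra K M]
          [IsScalarTower K₀ (N w) M] [IsScalarTower K₀ K M],
          IntermediateField.adjoin (N w) (Set.range (algebraMap K M)) = ⊤ →
          -- the valuation of `N w` extends uniquely to `M`
          ∃ U : ValuationSubring M,
            ValuedFieldExt.Extends (VN w) U ∧
            (∀ U' : ValuationSubring M, ValuedFieldExt.Extends (VN w) U' → U' = U) ∧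
            ValuedFieldExt.IsMaximalImmediate W U ∧
            ValuedFieldExt.IsRelSepClosed K M := by
  intro w
  obtain ⟨hfin, hsum⟩ := hdl
  have huniq (w : Set.Ici V₀) {W W' : ValuationSubring K} (hW : Extends w.1 W)
      (hW' : Extends w.1 W') : W' = W :=
    (hN w).1.1.eq_of_extends (hN w).2.isSphericallyComplete (hNsep w) hW hW'
  -- Uniqueness for `v` itself reduces the fundamental equality to the single term `e f`.
  obtain ⟨ι, _, b, hb⟩ := hV.exists_isValuationBasis (by
    let : Unique {V' : ValuationSubring K // Extends V₀ V'} :=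
      ⟨⟨⟨V, hV⟩⟩, fun V' => Subtype.ext (huniq ⟨V₀, Set.self_mem_Ici⟩ hV V'.2)⟩
    rw [hsum, finsum_unique]
    rfl)
  obtain ⟨W, hVW, hW⟩ := hV.exists_coarsening w.2
  refine ⟨W, ⟨hVW, hW⟩, fun W' _ hW' => huniq w hW hW', ?_⟩
  intro M _ _ _ _ _ _ hM
  have hbW := hb.of_le hVW
  have hspan := span_range_algebraMap_eq_top b hM
  have hrep (x : M) : ∃ c : ι → N w, ∑ i, c i • algebraMap K M (b i) = x :=
    (Submodule.mem_span_range_iff_exists_fun (N w)).1 (hspan ▸ Submodule.mem_top)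
  obtain ⟨a, ha0, ha⟩ := (hN w).1.exists_approximation
  have hWU {U : ValuationSubring M} (hU : Extends (VN w) U) : Extends W U :=
    huniq w hW <| by
      refine ValuationSubring.ext _ _ fun x => ?_
      rw [ValuationSubring.mem_comap, ValuationSubring.mem_comap,
        ← IsScalarTower.algebraMap_apply, IsScalarTower.algebraMap_apply K₀ (N w) M, hU.mem_iff,
        (hN w).1.1.mem_iff]
  have happrox {U : ValuationSubring M} (hU : Extends (VN w) U) (c : ι → N w)
      (hc : ∑ i, c i • algebraMap K M (b i) ≠ 0) :=
    hbW.valuation_sum_sub_lt hU (hWU hU) ha0 ha c hc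
  -- The right-hand side does not involve `U`, so any two extensions to `M` have the same ring.
  have hmem {U : ValuationSubring M} (hU : Extends (VN w) U) (c : ι → N w)
      (hc : ∑ i, c i • algebraMap K M (b i) ≠ 0) :
      ∑ i, c i • algebraMap K M (b i) ∈ U ↔ ∑ i, a (c i) • b i ∈ W := by
    have := U.valuation.map_sub_eq_of_lt_right (happrox hU c hc)
    rw [sub_sub_cancel_left, Valuation.map_neg] at this
    rw [← (hWU hU).mem_iff, ← U.valuation_le_one_iff, ← U.valuation_le_one_iff, this]
  obtain ⟨U, hU⟩ := exists_extends (VN w) M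
  refine ⟨U, hU, fun U' hU' => ?_, ⟨?_, ?_⟩, (hNsep w).compositum hM⟩
  · ext x
    obtain ⟨c, rfl⟩ := hrep x
    by_cases hc : ∑ i, c i • algebraMap K M (b i) = 0
    · rw [hc]
      exact iff_of_true U'.zero_mem U.zero_mem
    · rw [hmem hU c hc, hmem hU' c hc]
  · refine isImmediate_of_exists_sub_lt (hWU hU) fun x hx => ?_
    obtain ⟨c, rfl⟩ := hrep x
    exact ⟨_, happrox hU c hx⟩
  · have := finiteDimensional_compositum (K₀ := K₀) hM
    -- `M` is a finite power of `N w` as a vector space. Submodules over the ring `U` are also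
    -- submodules over the ring of `N w`, so spherical completeness carries over.
    let φ : (Fin (Module.finrank (N w) M) → N w) ≃ₗ[N w] M :=
      (Module.finBasis (N w) M).equivFun.symm
    refine ((hN w).2.isSphericallyComplete.pi_fin _).of_surjective (σ := hU.ringMap)
      { toFun := φ
        map_add' := φ.map_add
        map_smul' := fun r y => ?_ } φ.surjective |>.isMaximal
    rw [show r • y = (r : N w) • y from rfl, φ.map_smul, Algebra.smul_def]
    rfl
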